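/- Let $\mathbb K\in\{\mathbb R,\mathbb C\}$ and let $H=H^+\oplus H^-$ be a $\mathbb Z_2$-graded Hilbert space over $\mathbb K$ with grading operator $\gamma$ (so $\gamma=\gamma^*$, $\gamma^2=1$, $H^\pm=\ker(\gamma\mp 1)$). An operator $T$ in $H$ is called odd if $\gamma$ maps the domain of $T$ into itself and $T\gamma=-\gamma T$ there. A (possibly unbounded) self-adjoint operator is called Fredholm if its kernel is finite-dimensional and its range is closed and of finite codimension. The set of all self-adjoint operators in $H$ carries the graph (gap) metric $d_G(T,S)=\|P_T-P_S\|$, where $P_T$ is the orthogonal projection of $H\oplus H$ onto the graph of $T$; for $\mathbb K=\mathbb C$ this equals $\|(T+i)^{-1}-(S+i)^{-1}\|$. (I) Let $G$ be a compact Lie group and $\varrho$ a (strongly continuous) unitary representation of $G$ on $H$ by even operators, i.e. $\varrho(g)\gamma=\gamma\varrho(g)$ for all $g\in G$. Let $\mathcal{CF}^{sa}_G$ be the set of odd self-adjoint Fredholm operators in $H$ commuting with all $\varrho(g)$ (in particular, $\varrho(g)$ preserves the domain). Let $R(G)$ be the Grothendieck group of equivalence classes of finite-dimensional continuous representations of $G$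 over $\mathbb K$. Then the $G$-index $$\operatorname{ind}_G:\mathcal{CF}^{sa}_G\to R(G),\qquad \operatorname{ind}_G T=[\ker T\cap H^+]-[\ker T\cap H^-],$$ is locally constant with respect to the topology induced by $d_G$. (II) Let $n\ge 0$, let $C\ell_n$ be the real Clifford algebra generated by $e_1,\dots,e_n$ with $e_ie_j+e_je_i=-2\delta_{ij}$, with the involution determined by $e_i^*=-e_i$ and graded so that the $e_i$ are odd, and let $\varrho$ be a unital graded $*$-representation of the real algebra $C\ell_n$ by bounded operators on $H$. Let $\mathcal{CF}^{sa}_n$ be the set of odd self-adjoint Fredholm operators in $H$ commuting with all $\varrho(a)$, $a\in C\ell_n$. Let $\hat{\mathcal M}_n$ be the Grothendieck group of equivalence classes of finite-dimensional real $\mathbb Z_2$-graded $C\ell_n$-modules, and let $\hat{\mathcal M}_n/\hat{\mathcal M}_{n+1}$ ($\cong KO^{-n}(pt)$) be the cokernel of the restriction homomorphism $\hat{\mathcal M}_{n+1}\to\hat{\mathcal M}_n$ given by $C\ell_n\subset C\ell_{n+1}$. Then the Clifford index $$\operatorname{ind}_n:\mathcal{CF}^{sa}_n\to \hat{\mathcal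 M}_n/\hat{\mathcal M}_{n+1},\qquad \operatorname{ind}_n T=[\ker T],$$ where $\ker T$ is regarded as a real graded $C\ell_n$-module, is locally constant with respect to the topology induced by $d_G$. -/

import Mathlib

open scoped Manifold ContDiff

noncomputable section

namespace EquivariantIndex

universe u

/-! ### Unbounded operators -/

section Operators

variable {𝕜 : Type*} [RCLike 𝕜] {H : Type u} [NormedAddCommGroup H] [InnerProductSpace 𝕜 H]

/-- The kernel `{x ∈ dom T | T x = 0}` of an unbounded operator, as a subspace of `H`. -/
def opKer (T : H →ₗ.[𝕜] H) : Submodule 𝕜 H := (LinearMap.ker T.toFun).map T.domain.subtype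

/-- The range of an unbounded operator. -/
def opRange (T : H →ₗ.[𝕜] H) : Submodule 𝕜 H := LinearMap.range T.toFun

lemma mem_opKer {T : H →ₗ.[𝕜] H} {x : H} :
    x ∈ opKer T ↔ ∃ h : x ∈ T.domain, T ⟨x, h⟩ = 0 := by
  simp only [opKer, Submodule.mem_map, LinearMap.mem_ker, Submodule.subtype_apply]
  constructor
  · rintro ⟨y, hy, rfl⟩
    exact ⟨y.2, hy⟩
  · rintro ⟨h, hx⟩
    exact ⟨⟨x, h⟩, hx, rfl⟩

/-- Fredholm operators: densely defined closed operators with finite-dimensional kernel and closed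
range of finite codimension. -/
structure IsFredholm (T : H →ₗ.[𝕜] H) : Prop where
  dense : Dense (T.domain : Set H)
  closed : T.IsClosed
  finite_ker : FiniteDimensional 𝕜 (opKer T)
  closed_range : IsClosed (opRange T : Set H)
  finite_coker : FiniteDimensional 𝕜 (H ⧸ opRange T)

/-- The bounded operator `A` maps `dom T` into itself and `T A = A T` there. -/
def OpCommutes (T : H →ₗ.[𝕜] H) (A : H →L[𝕜] H) : Prop :=
  ∀ x : T.domain, ∃ h : A x ∈ T.domain, T ⟨A x, h⟩ = A (T x)

/-- `T` is odd with respect to the grading operator `γ`: `γ` maps `dom T` into itself and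
`T γ = - γ T` there. -/
def IsOdd (γ : H →L[𝕜] H) (T : H →ₗ.[𝕜] H) : Prop :=
  ∀ x : T.domain, ∃ h : γ x ∈ T.domain, T ⟨γ x, h⟩ = - γ (T x)

/-- A grading operator, i.e. a self-adjoint involution; the grading is
`H = ker (γ - 1) ⊕ ker (γ + 1)`. -/
structure IsGrading [CompleteSpace H] (γ : H →L[𝕜] H) : Prop where
  selfAdjoint : IsSelfAdjoint γ
  sq : γ * γ = 1

lemma opKer_invariant {T : H →ₗ.[𝕜] H} {A : H →L[𝕜] H} (h : OpCommutes T A) :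
    ∀ x ∈ opKer T, A x ∈ opKer T := by
  intro x hx
  obtain ⟨h0, hx0⟩ := mem_opKer.1 hx
  obtain ⟨h1, h2⟩ := h ⟨x, h0⟩
  exact mem_opKer.2 ⟨h1, by rw [h2, hx0, map_zero]⟩

lemma opKer_invariant_of_odd {T : H →ₗ.[𝕜] H} {γ : H →L[𝕜] H} (h : IsOdd γ T) :
    ∀ x ∈ opKer T, γ x ∈ opKer T := by
  intro x hx
  obtain ⟨h0, hx0⟩ := mem_opKer.1 hx
  obtain ⟨h1, h2⟩ := h ⟨x, h0⟩
  exact mem_opKer.2 ⟨h1, by rw [h2, hx0, map_zero, neg_zero]⟩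

end Operators

/-! ### The graph metric on the space of self-adjoint operators -/

section GraphMetric

variable (𝕜 : Type*) [RCLike 𝕜] (H : Type u) [NormedAddCommGroup H] [InnerProductSpace 𝕜 H]
  [CompleteSpace H]

/-- The set of all (possibly unbounded) self-adjoint operators in `H`. -/
def SAOp : Type u := {T : H →ₗ.[𝕜] H // IsSelfAdjoint T}

variable {𝕜 H}

/-- The graph of `T` as a subspace of the Hilbert space `H ⊕ H`. -/
def graphL2 (T : H →ₗ.[𝕜] H) : Submodule 𝕜 (WithLp 2 (H × H)) :=
  T.graph.comap (WithLp.linearEquiv 2 𝕜 (H × H)).toLinearMap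

lemma isClosed_graphL2 (T : SAOp 𝕜 H) : IsClosed (graphL2 T.1 : Set (WithLp 2 (H × H))) :=
  (show IsClosed (T.1.graph : Set (H × H)) from T.2.isClosed).preimage
    (WithLp.prodContinuousLinearEquiv 2 𝕜 H H).continuous

instance (T : SAOp 𝕜 H) : (graphL2 T.1).HasOrthogonalProjection :=
  haveI : CompleteSpace (graphL2 T.1) := (isClosed_graphL2 T).completeSpace_coe
  inferInstance

/-- The orthogonal projection of `H ⊕ H` onto the graph of `T`. -/
def graphProj (T : SAOp 𝕜 H) : WithLp 2 (H × H) →L[𝕜] WithLp 2 (H × H) :=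
  (graphL2 T.1).starProjection

/-- The graph (or gap) metric `d(T, S) = ‖P_T - P_S‖`, where `P_T` is the orthogonal projection
onto the graph of `T`. Over `ℂ` it is equal to `‖(T + i)⁻¹ - (S + i)⁻¹‖`, see
`dist_eq_norm_resolvent_sub` below. -/
instance : PseudoMetricSpace (SAOp 𝕜 H) := PseudoMetricSpace.induced graphProj inferInstance

lemma graph_symm {T : SAOp 𝕜 H} {a b c d : H} (h : (a, b) ∈ T.1.graph) (h' : (c, d) ∈ T.1.graph) :
    inner 𝕜 b c = inner 𝕜 a d := by
  have key : (c, d) ∈ T.1.graph.adjoint := by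
    rw [← LinearPMap.adjoint_graph_eq_graph_adjoint T.2.dense_domain,
      LinearPMap.isSelfAdjoint_def.1 T.2]
    exact h'
  exact sub_eq_zero.1 ((Submodule.mem_adjoint_iff _ _).1 key a b h)

lemma mem_graph_of_forall {T : SAOp 𝕜 H} {c d : H}
    (h : ∀ a b, (a, b) ∈ T.1.graph → inner 𝕜 b c = inner 𝕜 a d) : (c, d) ∈ T.1.graph := by
  have key : (c, d) ∈ T.1.graph.adjoint :=
    (Submodule.mem_adjoint_iff _ _).2 fun a b hab => sub_eq_zero.2 (h a b hab)
  rwa [← LinearPMap.adjoint_graph_eq_graph_adjoint T.2.dense_domain,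
    LinearPMap.isSelfAdjoint_def.1 T.2] at key

/-- The operator `(1 + T²)⁻¹`, the upper left corner of the graph projection. -/
def opC (T : SAOp 𝕜 H) : H →L[𝕜] H :=
  (ContinuousLinearMap.fst 𝕜 H H) ∘L (WithLp.prodContinuousLinearEquiv 2 𝕜 H H).toContinuousLinearMap
    ∘L graphProj T ∘L (WithLp.prodContinuousLinearEquiv 2 𝕜 H H).symm.toContinuousLinearMap
    ∘L ContinuousLinearMap.inl 𝕜 H H

/-- The operator `T (1 + T²)⁻¹`, the lower left corner of the graph projection. -/
def opB (T : SAOp 𝕜 H) : H →L[𝕜] H :=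
  (ContinuousLinearMap.snd 𝕜 H H) ∘L (WithLp.prodContinuousLinearEquiv 2 𝕜 H H).toContinuousLinearMap
    ∘L graphProj T ∘L (WithLp.prodContinuousLinearEquiv 2 𝕜 H H).symm.toContinuousLinearMap
    ∘L ContinuousLinearMap.inl 𝕜 H H

lemma graphProj_inl (T : SAOp 𝕜 H) (x : H) :
    graphProj T (WithLp.toLp 2 (x, 0)) = WithLp.toLp 2 (opC T x, opB T x) := rfl

lemma graph_opC (T : SAOp 𝕜 H) (x : H) : (opC T x, opB T x) ∈ T.1.graph := by
  have h := (graphL2 T.1).starProjection_apply_mem (WithLp.toLp 2 (x, 0))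
  rw [← graphProj, graphProj_inl] at h
  exact h

lemma graph_opB (T : SAOp 𝕜 H) (x : H) : (opB T x, x - opC T x) ∈ T.1.graph := by
  refine mem_graph_of_forall fun a b hab => ?_
  have h := (graphL2 T.1).starProjection_inner_eq_zero (WithLp.toLp 2 (x, 0))
    (WithLp.toLp 2 (a, b)) hab
  rw [← graphProj, graphProj_inl, ← inner_conj_symm, map_eq_zero] at h
  simp only [WithLp.prod_inner_apply, WithLp.ofLp_sub, Prod.fst_sub, Prod.snd_sub, zero_sub,
    inner_neg_right] at h
  linear_combination -h

lemma graphProj_apply (T : SAOp 𝕜 H) (x y : H) : graphProj T (WithLp.toLp 2 (x, y)) =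
    WithLp.toLp 2 (opC T x + opB T y, opB T x + (y - opC T y)) := by
  have h1 : graphProj T (WithLp.toLp 2 (0, y)) = WithLp.toLp 2 (opB T y, y - opC T y) := by
    refine (Submodule.eq_starProjection_of_mem_of_inner_eq_zero (K := graphL2 T.1)
      (graph_opB T y) ?_)
    intro w hw
    have := graph_symm (T := T) hw (graph_opC T y)
    rw [← inner_conj_symm, map_eq_zero]
    simp only [WithLp.prod_inner_apply, WithLp.ofLp_sub, Prod.fst_sub, Prod.snd_sub, zero_sub,
      inner_neg_right, sub_sub_cancel]
    linear_combination this
  have h2 : (WithLp.toLp 2 (x, y) : WithLp 2 (H × H)) =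
      WithLp.toLp 2 (x, 0) + WithLp.toLp 2 (0, y) := by
    rw [← WithLp.toLp_add]; simp
  rw [h2, map_add, h1, graphProj_inl, ← WithLp.toLp_add, Prod.mk_add_mk]

lemma opC_symm (T : SAOp 𝕜 H) (x y : H) : inner 𝕜 (opC T x) y = inner 𝕜 x (opC T y) := by
  have h1 := graph_symm (T := T) (graph_opC T x) (graph_opB T y)
  have h2 := graph_symm (T := T) (graph_opB T x) (graph_opC T y)
  rw [inner_sub_left] at h2
  rw [inner_sub_right] at h1
  linear_combination -h1 - h2

lemma opB_symm (T : SAOp 𝕜 H) (x y : H) : inner 𝕜 (opB T x) y = inner 𝕜 x (opB T y) := by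
  have h1 := graph_symm (T := T) (graph_opC T x) (graph_opC T y)
  have h2 := graph_symm (T := T) (graph_opB T x) (graph_opB T y)
  rw [inner_sub_left, inner_sub_right] at h2
  linear_combination h1 - h2

end GraphMetric

/-! ### The graph metric over the complex numbers in terms of resolvents -/

section Resolvent

variable {H : Type u} [NormedAddCommGroup H] [InnerProductSpace ℂ H] [CompleteSpace H]

/-- The bounded operator `R` is the inverse of `T + i`. -/
def IsInverseAddI (T : H →ₗ.[ℂ] H) (R : H →L[ℂ] H) : Prop :=
  (∀ x, ∃ h : R x ∈ T.domain, T ⟨R x, h⟩ + Complex.I • R x = x) ∧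
    ∀ x : T.domain, R (T x + Complex.I • (x : H)) = x

lemma injective_add_I (T : SAOp ℂ H) {u v : H} (h : (u, v) ∈ T.1.graph)
    (h0 : v + Complex.I • u = 0) : u = 0 := by
  have h1 := graph_symm h h
  have h2 : v = -(Complex.I • u) := eq_neg_of_add_eq_zero_left h0
  rw [h2, inner_neg_left, inner_neg_right, inner_smul_left, inner_smul_right, Complex.conj_I] at h1
  have h3 : (2 * Complex.I) * inner ℂ u u = 0 := by linear_combination h1
  simpa using h3

lemma graph_resolvent (T : SAOp ℂ H) (x : H) :
    ((opB T - Complex.I • opC T) x, x - Complex.I • (opB T - Complex.I • opC T) x)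
      ∈ T.1.graph := by
  have h := T.1.graph.sub_mem (graph_opB T x) (T.1.graph.smul_mem Complex.I (graph_opC T x))
  convert h using 1
  simp [smul_sub, smul_smul]
  abel

lemma isInverseAddI_resolvent (T : SAOp ℂ H) :
    IsInverseAddI T.1 (opB T - Complex.I • opC T) := by
  refine ⟨fun x => ?_, fun x => ?_⟩
  · obtain ⟨y, hy1, hy2⟩ := (LinearPMap.mem_graph_iff _).1 (graph_resolvent T x)
    have hd : (opB T - Complex.I • opC T) x ∈ T.1.domain := by
      have := y.2
      rwa [hy1] at this
    refine ⟨hd, ?_⟩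
    have : y = ⟨_, hd⟩ := Subtype.ext hy1
    rw [← this, hy2]
    simp
  · have h := T.1.graph.sub_mem (graph_resolvent T (T.1 x + Complex.I • (x : H)))
      (T.1.mem_graph x)
    refine sub_eq_zero.1 (injective_add_I T h ?_)
    simp only [smul_sub]
    abel

lemma IsInverseAddI.unique (T : SAOp ℂ H) {R : H →L[ℂ] H} (hR : IsInverseAddI T.1 R) :
    R = opB T - Complex.I • opC T := by
  ext x
  obtain ⟨h, hx⟩ := (isInverseAddI_resolvent T).1 x
  have := hR.2 ⟨_, h⟩
  rw [hx] at this
  exact this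

/-- Every self-adjoint operator `T` in a complex Hilbert space has a bounded inverse
`(T + i)⁻¹`. -/
theorem exists_isInverseAddI (T : SAOp ℂ H) : ∃ R : H →L[ℂ] H, IsInverseAddI T.1 R :=
  ⟨_, isInverseAddI_resolvent T⟩

/-- Over `ℂ` the graph metric is `d(T, S) = ‖(T + i)⁻¹ - (S + i)⁻¹‖`. -/
theorem dist_eq_norm_resolvent_sub (T S : SAOp ℂ H) {R R' : H →L[ℂ] H}
    (hR : IsInverseAddI T.1 R) (hR' : IsInverseAddI S.1 R') : dist T S = ‖R - R'‖ := by
  rw [hR.unique, hR'.unique]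
  change dist (graphProj T) (graphProj S) = _
  rw [dist_eq_norm]
  set c : H →L[ℂ] H := opC T - opC S with hc
  set b : H →L[ℂ] H := opB T - opB S with hb
  have hr : opB T - Complex.I • opC T - (opB S - Complex.I • opC S) = b - Complex.I • c := by
    rw [hb, hc, smul_sub]; abel
  rw [hr]
  have hD : ∀ x y : H, (graphProj T - graphProj S) (WithLp.toLp 2 (x, y)) =
      WithLp.toLp 2 (c x + b y, b x - c y) := by
    intro x y
    rw [sub_apply, graphProj_apply, graphProj_apply, ← WithLp.toLp_sub,
      Prod.mk_sub_mk]
    simp only [hb, hc, sub_apply]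
    congr 2 <;> abel
  have hadj : ContinuousLinearMap.adjoint (b - Complex.I • c) = b + Complex.I • c := by
    symm
    rw [ContinuousLinearMap.eq_adjoint_iff]
    intro x y
    simp only [hb, hc, sub_apply, add_apply,
      _root_.smul_apply, inner_sub_left, inner_sub_right, inner_add_left,
      inner_smul_left, inner_smul_right, opB_symm, opC_symm, Complex.conj_I]
    ring
  have hnorm : ‖b + Complex.I • c‖ = ‖b - Complex.I • c‖ := by
    rw [← hadj, LinearIsometryEquiv.norm_map]
  have e1 : ∀ x y : H, (b - Complex.I • c) (x - Complex.I • y) =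
      (b x - c y) - Complex.I • (c x + b y) := by
    intro x y
    simp [smul_sub, smul_add, smul_smul]
    abel
  have e2 : ∀ x y : H, (b + Complex.I • c) (x + Complex.I • y) =
      (b x - c y) + Complex.I • (c x + b y) := by
    intro x y
    simp [smul_add, smul_smul]
    abel
  have par : ∀ p q : H, ‖q - Complex.I • p‖ ^ 2 + ‖q + Complex.I • p‖ ^ 2 =
      2 * (‖p‖ ^ 2 + ‖q‖ ^ 2) := by
    intro p q
    have := parallelogram_law_with_norm ℂ q (Complex.I • p)
    rw [norm_smul, Complex.norm_I, one_mul] at this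
    linarith
  apply le_antisymm
  · refine ContinuousLinearMap.opNorm_le_bound _ (norm_nonneg _) fun w => ?_
    obtain ⟨⟨x, y⟩, rfl⟩ := (WithLp.equiv 2 (H × H)).symm.surjective w
    change ‖(graphProj T - graphProj S) (WithLp.toLp 2 (x, y))‖ ≤ _ * ‖WithLp.toLp 2 (x, y)‖
    rw [hD]
    refine (sq_le_sq₀ (norm_nonneg _) (by positivity)).1 ?_
    rw [mul_pow, WithLp.prod_norm_sq_eq_of_L2, WithLp.prod_norm_sq_eq_of_L2]
    have h1 := (b - Complex.I • c).le_opNorm (x - Complex.I • y)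
    have h2 := (b + Complex.I • c).le_opNorm (x + Complex.I • y)
    rw [e1] at h1
    rw [e2, hnorm] at h2
    have h1' := pow_le_pow_left₀ (norm_nonneg _) h1 2
    have h2' := pow_le_pow_left₀ (norm_nonneg _) h2 2
    have p1 := par (c x + b y) (b x - c y)
    have p2 := par y x
    rw [mul_pow] at h1' h2'
    simp only [WithLp.toLp_fst, WithLp.toLp_snd]
    nlinarith
  · refine ContinuousLinearMap.opNorm_le_bound _ (norm_nonneg _) fun v => ?_
    refine (sq_le_sq₀ (norm_nonneg _) (by positivity)).1 ?_
    have h1 := e1 ((1 / 2 : ℂ) • v) ((Complex.I / 2) • v)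
    have h2 := e2 ((1 / 2 : ℂ) • v) ((Complex.I / 2) • v)
    have hv : (1 / 2 : ℂ) • v - Complex.I • (Complex.I / 2) • v = v := by
      rw [smul_smul, ← sub_smul]
      have : (1 / 2 - Complex.I * (Complex.I / 2) : ℂ) = 1 := by
        linear_combination (-1 / 2 : ℂ) * Complex.I_mul_I
      rw [this, one_smul]
    have hv' : (1 / 2 : ℂ) • v + Complex.I • (Complex.I / 2) • v = 0 := by
      rw [smul_smul, ← add_smul]
      have : (1 / 2 + Complex.I * (Complex.I / 2) : ℂ) = 0 := by
        linear_combination (1 / 2 : ℂ) * Complex.I_mul_I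
      rw [this, zero_smul]
    rw [hv] at h1
    rw [hv', map_zero] at h2
    set x : H := (1 / 2 : ℂ) • v with hx
    set y : H := (Complex.I / 2) • v with hy
    have h3 := pow_le_pow_left₀ (norm_nonneg _)
      ((graphProj T - graphProj S).le_opNorm (WithLp.toLp 2 (x, y))) 2
    rw [hD, mul_pow, WithLp.prod_norm_sq_eq_of_L2, WithLp.prod_norm_sq_eq_of_L2] at h3
    simp only [WithLp.toLp_fst, WithLp.toLp_snd] at h3
    have p1 := par (c x + b y) (b x - c y)
    rw [← h1, ← h2, norm_zero] at p1
    have nx : ‖x‖ = ‖v‖ / 2 := by rw [hx, norm_smul]; norm_num; ring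
    have ny : ‖y‖ = ‖v‖ / 2 := by rw [hy, norm_smul]; norm_num; ring
    rw [nx, ny] at h3
    rw [mul_pow]
    nlinarith

end Resolvent

/-! ### The representation group `R(G)` -/

section RepresentationGroup

variable (𝕜 : Type*) [RCLike 𝕜] (G : Type*) [Group G] [TopologicalSpace G]

/-- Finite-dimensional continuous representations of `G` over `𝕜`. -/
structure GModule where
  carrier : Type u
  [addCommGroup : AddCommGroup carrier]
  [module : Module 𝕜 carrier]
  [finite : FiniteDimensional 𝕜 carrier]
  action : Representation 𝕜 G carrier
  /-- Continuity, expressed through the matrix coefficients. -/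
  continuous_coeff : ∀ (v : carrier) (φ : Module.Dual 𝕜 carrier),
    Continuous fun g => φ (action g v)

attribute [instance] GModule.addCommGroup GModule.module GModule.finite

namespace GModule

variable {𝕜 G}

/-- Two representations are equivalent if there is an equivariant linear isomorphism. -/
def Equivalent (V W : GModule.{u} 𝕜 G) : Prop :=
  ∃ e : V.carrier ≃ₗ[𝕜] W.carrier, ∀ g v, e (V.action g v) = W.action g (e v)

instance setoid : Setoid (GModule.{u} 𝕜 G) where
  r := Equivalent
  iseqv :=
    { refl := fun V => ⟨LinearEquiv.refl 𝕜 _, fun _ _ => rfl⟩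
      symm := by
        rintro V W ⟨e, he⟩
        refine ⟨e.symm, fun g w => ?_⟩
        rw [LinearEquiv.symm_apply_eq, he, LinearEquiv.apply_symm_apply]
      trans := by
        rintro V W X ⟨e, he⟩ ⟨f, hf⟩
        exact ⟨e.trans f, fun g v => by simp [he, hf]⟩ }

/-- The direct sum of two representations. -/
def directSum (V W : GModule.{u} 𝕜 G) : GModule.{u} 𝕜 G where
  carrier := V.carrier × W.carrier
  action :=
    { toFun := fun g => (V.action g).prodMap (W.action g)
      map_one' := by ext <;> simp
      map_mul' := fun g h => by ext <;> simp }
  continuous_coeff := fun v φ => by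
    have h1 := V.continuous_coeff v.1 (φ ∘ₗ LinearMap.inl 𝕜 _ _)
    have h2 := W.continuous_coeff v.2 (φ ∘ₗ LinearMap.inr 𝕜 _ _)
    refine (h1.add h2).congr fun g => ?_
    simp [← map_add]

/-- The zero representation. -/
def zero : GModule.{u} 𝕜 G where
  carrier := PUnit
  action := 1
  continuous_coeff := fun v φ =>
    (continuous_const : Continuous fun _ : G => φ v)

instance : Unique (zero.{u} (𝕜 := 𝕜) (G := G)).carrier := inferInstanceAs (Unique PUnit)

end GModule

/-- Equivalence classes of finite-dimensional representations of `G`. -/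
def GModuleClass := Quotient (GModule.setoid.{u} (𝕜 := 𝕜) (G := G))

/-- Addition of equivalence classes is the direct sum. -/
instance : Add (GModuleClass.{u} 𝕜 G) where
  add := Quotient.map₂ GModule.directSum (by
    rintro V V' ⟨e, he⟩ W W' ⟨f, hf⟩
    exact ⟨e.prodCongr f, fun g v => Prod.ext (he g v.1) (hf g v.2)⟩)

instance : Zero (GModuleClass.{u} 𝕜 G) where
  zero := Quotient.mk _ GModule.zero

instance : AddCommMonoid (GModuleClass.{u} 𝕜 G) where
  add_assoc := by
    rintro ⟨V⟩ ⟨W⟩ ⟨X⟩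
    exact Quotient.sound ⟨LinearEquiv.prodAssoc 𝕜 _ _ _, fun _ _ => rfl⟩
  zero_add := by
    rintro ⟨V⟩
    exact Quotient.sound ⟨LinearEquiv.uniqueProd, fun _ _ => rfl⟩
  add_zero := by
    rintro ⟨V⟩
    exact Quotient.sound ⟨LinearEquiv.prodUnique, fun _ _ => rfl⟩
  add_comm := by
    rintro ⟨V⟩ ⟨W⟩
    exact Quotient.sound ⟨LinearEquiv.prodComm 𝕜 _ _, fun _ _ => rfl⟩
  nsmul := nsmulRec

/-- (The additive group of) the representation ring `R(G)`: the Grothendieck group of the monoid of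
equivalence classes of finite-dimensional representations. -/
abbrev RepGroup := Algebra.GrothendieckAddGroup (GModuleClass.{u} 𝕜 G)

variable {𝕜 G}

/-- The class `[V] ∈ R(G)`. -/
def repClass (V : GModule.{u} 𝕜 G) : RepGroup.{u} 𝕜 G :=
  Algebra.GrothendieckAddGroup.of (Quotient.mk _ V : GModuleClass.{u} 𝕜 G)

end RepresentationGroup

/-! ### Graded Clifford modules -/

section Clifford

/-- The negative definite form `Q(x) = - ∑ xᵢ²` on `ℝⁿ`. -/
def negForm (n : ℕ) : QuadraticForm ℝ (Fin n → ℝ) :=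
  QuadraticMap.weightedSumSquares ℝ fun _ : Fin n => (-1 : ℝ)

/-- The real Clifford algebra `Cℓ_n`, generated by `e_1, …, e_n` with
`e_i e_j + e_j e_i = - 2 δ_ij`. Its star structure is given by `e_i* = - e_i`, and its grading
automorphism `CliffordAlgebra.involute` by `e_i ↦ - e_i`. -/
abbrev Cl (n : ℕ) := CliffordAlgebra (negForm n)

/-- The isometric inclusion `ℝⁿ → ℝⁿ⁺¹`, `x ↦ (x, 0)`. -/
def negFormIncl (n : ℕ) : negForm n →qᵢ negForm (n + 1) where
  toFun := fun x => Fin.snoc (α := fun _ => ℝ) x 0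
  map_add' := fun x y => by
    ext i
    refine Fin.lastCases ?_ (fun i => ?_) i <;> simp
  map_smul' := fun r x => by
    ext i
    refine Fin.lastCases ?_ (fun i => ?_) i <;> simp
  map_app' := fun x => by
    simp [negForm, QuadraticMap.weightedSumSquares_apply, Fin.sum_univ_castSucc]

/-- The inclusion `Cℓ_n → Cℓ_{n+1}`, `e_i ↦ e_i`. -/
def clIncl (n : ℕ) : Cl n →ₐ[ℝ] Cl (n + 1) := CliffordAlgebra.map (negFormIncl n)

lemma clIncl_involute (n : ℕ) (a : Cl n) :
    clIncl n (CliffordAlgebra.involute a) = CliffordAlgebra.involute (clIncl n a) := by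
  have : (clIncl n).comp CliffordAlgebra.involute = CliffordAlgebra.involute.comp (clIncl n) := by
    ext x
    simp [clIncl]
  exact DFunLike.congr_fun this a

/-- Finite-dimensional `ℤ₂`-graded `Cℓ_n`-modules. The grading `V = ker (γ - 1) ⊕ ker (γ + 1)` is
encoded by the grading operator `γ`; even elements of `Cℓ_n` act by even and odd ones by odd
operators. -/
structure GradedClModule (n : ℕ) where
  carrier : Type u
  [addCommGroup : AddCommGroup carrier]
  [module : Module ℝ carrier]
  [finite : FiniteDimensional ℝ carrier]
  action : Cl n →ₐ[ℝ] Module.End ℝ carrier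
  grading : Module.End ℝ carrier
  grading_sq : grading * grading = 1
  graded : ∀ a, grading * action a = action (CliffordAlgebra.involute a) * grading

attribute [instance] GradedClModule.addCommGroup GradedClModule.module GradedClModule.finite

namespace GradedClModule

variable {n : ℕ}

/-- Two graded modules are equivalent if there is a `Cℓ_n`-linear isomorphism which preserves the
grading. -/
def Equivalent (V W : GradedClModule.{u} n) : Prop :=
  ∃ e : V.carrier ≃ₗ[ℝ] W.carrier, (∀ a v, e (V.action a v) = W.action a (e v)) ∧
    ∀ v, e (V.grading v) = W.grading (e v)

instance setoid (n : ℕ) : Setoid (GradedClModule.{u} n) where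
  r := Equivalent
  iseqv :=
    { refl := fun V => ⟨LinearEquiv.refl ℝ _, fun _ _ => rfl, fun _ => rfl⟩
      symm := by
        rintro V W ⟨e, he, he'⟩
        refine ⟨e.symm, fun g w => ?_, fun w => ?_⟩
        · rw [LinearEquiv.symm_apply_eq, he, LinearEquiv.apply_symm_apply]
        · rw [LinearEquiv.symm_apply_eq, he', LinearEquiv.apply_symm_apply]
      trans := by
        rintro V W X ⟨e, he, he'⟩ ⟨f, hf, hf'⟩
        exact ⟨e.trans f, fun g v => by simp [he, hf], fun v => by simp [he', hf']⟩ }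

/-- The direct sum of two graded modules. -/
def directSum (V W : GradedClModule.{u} n) : GradedClModule.{u} n where
  carrier := V.carrier × W.carrier
  action := AlgHom.ofLinearMap
    { toFun := fun a => (V.action a).prodMap (W.action a)
      map_add' := fun a b => by ext <;> simp
      map_smul' := fun r a => by ext <;> simp }
    (by ext <;> simp) (fun a b => by ext <;> simp)
  grading := V.grading.prodMap W.grading
  grading_sq := by
    have h1 := V.grading_sq
    have h2 := W.grading_sq
    refine LinearMap.ext fun v => Prod.ext ?_ ?_
    · exact LinearMap.congr_fun h1 v.1
    · exact LinearMap.congr_fun h2 v.2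
  graded := fun a => by
    refine LinearMap.ext fun v => Prod.ext ?_ ?_
    · exact LinearMap.congr_fun (V.graded a) v.1
    · exact LinearMap.congr_fun (W.graded a) v.2

/-- The zero module. -/
def zero (n : ℕ) : GradedClModule.{u} n where
  carrier := PUnit
  action := AlgHom.ofLinearMap 0 (Subsingleton.elim _ _) fun _ _ => Subsingleton.elim _ _
  grading := 1
  grading_sq := one_mul 1
  graded := fun _ => Subsingleton.elim _ _

instance : Unique (zero.{u} n).carrier := inferInstanceAs (Unique PUnit)

/-- The restriction of a graded `Cℓ_{n+1}`-module to `Cℓ_n`. -/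
def restrict (V : GradedClModule.{u} (n + 1)) : GradedClModule.{u} n where
  carrier := V.carrier
  action := V.action.comp (clIncl n)
  grading := V.grading
  grading_sq := V.grading_sq
  graded := fun a => by
    rw [AlgHom.comp_apply, AlgHom.comp_apply, clIncl_involute]
    exact V.graded _

end GradedClModule

/-- Equivalence classes of finite-dimensional graded `Cℓ_n`-modules. -/
def GradedClModuleClass (n : ℕ) := Quotient (GradedClModule.setoid.{u} n)

/-- Addition of equivalence classes is the direct sum. -/
instance (n : ℕ) : Add (GradedClModuleClass.{u} n) where
  add := Quotient.map₂ GradedClModule.directSum (by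
    rintro V V' ⟨e, he, he'⟩ W W' ⟨f, hf, hf'⟩
    exact ⟨e.prodCongr f, fun a v => Prod.ext (he a v.1) (hf a v.2),
      fun v => Prod.ext (he' v.1) (hf' v.2)⟩)

instance (n : ℕ) : Zero (GradedClModuleClass.{u} n) where
  zero := Quotient.mk _ (GradedClModule.zero n)

instance (n : ℕ) : AddCommMonoid (GradedClModuleClass.{u} n) where
  add_assoc := by
    rintro ⟨V⟩ ⟨W⟩ ⟨X⟩
    exact Quotient.sound ⟨LinearEquiv.prodAssoc ℝ _ _ _, fun _ _ => rfl, fun _ => rfl⟩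
  zero_add := by
    rintro ⟨V⟩
    exact Quotient.sound ⟨LinearEquiv.uniqueProd, fun _ _ => rfl, fun _ => rfl⟩
  add_zero := by
    rintro ⟨V⟩
    exact Quotient.sound ⟨LinearEquiv.prodUnique, fun _ _ => rfl, fun _ => rfl⟩
  add_comm := by
    rintro ⟨V⟩ ⟨W⟩
    exact Quotient.sound ⟨LinearEquiv.prodComm ℝ _ _, fun _ _ => rfl, fun _ => rfl⟩
  nsmul := nsmulRec

/-- The Grothendieck group `M̂_n` of finite-dimensional graded `Cℓ_n`-modules. -/
abbrev MHat (n : ℕ) := Algebra.GrothendieckAddGroup (GradedClModuleClass.{u} n)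

/-- Restriction to `Cℓ_n` on equivalence classes. -/
def restrictClass (n : ℕ) : GradedClModuleClass.{u} (n + 1) →+ GradedClModuleClass.{u} n where
  toFun := Quotient.map GradedClModule.restrict (by
    rintro V W ⟨e, he, he'⟩
    exact ⟨e, fun a v => he _ v, he'⟩)
  map_zero' := Quotient.sound
    ⟨LinearEquiv.refl ℝ _, fun _ _ => Subsingleton.elim (α := PUnit) _ _, fun _ => rfl⟩
  map_add' := by
    rintro ⟨V⟩ ⟨W⟩
    exact Quotient.sound ⟨LinearEquiv.refl ℝ _, fun _ _ => rfl, fun _ => rfl⟩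

/-- The restriction homomorphism `M̂_{n+1} → M̂_n`. -/
def restrictHom (n : ℕ) : MHat.{u} (n + 1) →+ MHat.{u} n :=
  Algebra.GrothendieckAddGroup.lift (Algebra.GrothendieckAddGroup.of.comp (restrictClass n))

/-- The group `M̂_n / M̂_{n+1}` (isomorphic to `KO⁻ⁿ(pt)`), i.e. the cokernel of the restriction
homomorphism `M̂_{n+1} → M̂_n`. -/
abbrev KOGroup (n : ℕ) := MHat.{u} n ⧸ (restrictHom.{u} n).range

/-- The class `[V] ∈ M̂_n / M̂_{n+1}`. -/
def clClass {n : ℕ} (V : GradedClModule.{u} n) : KOGroup.{u} n :=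
  QuotientAddGroup.mk
    (Algebra.GrothendieckAddGroup.of (Quotient.mk _ V : GradedClModuleClass.{u} n))

end Clifford

/-! ### The `G`-index -/

section GIndex

variable {𝕜 : Type*} [RCLike 𝕜] {H : Type u} [NormedAddCommGroup H] [InnerProductSpace 𝕜 H]
  [CompleteSpace H]

/-- A (strongly continuous) unitary representation of `G` by even operators on the graded Hilbert
space `(H, γ)`. -/
structure EvenUnitaryRep (G : Type*) [Group G] [TopologicalSpace G] (γ : H →L[𝕜] H) where
  toHom : G →* unitary (H →L[𝕜] H)
  continuous : ∀ x : H, Continuous fun g => (toHom g : H →L[𝕜] H) x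
  even : ∀ g, (toHom g : H →L[𝕜] H) * γ = γ * (toHom g : H →L[𝕜] H)

variable {G : Type*} [Group G] [TopologicalSpace G] {γ : H →L[𝕜] H}

/-- The set of odd `G`-equivariant self-adjoint Fredholm operators in `H`. -/
def CFsaG (ρ : EvenUnitaryRep G γ) : Set (SAOp 𝕜 H) :=
  {T | IsFredholm T.1 ∧ IsOdd γ T.1 ∧ ∀ g, OpCommutes T.1 (ρ.toHom g : H →L[𝕜] H)}

/-- A finite-dimensional `G`-invariant subspace as a representation. -/
def EvenUnitaryRep.subrep (ρ : EvenUnitaryRep G γ) (W : Submodule 𝕜 H) [FiniteDimensional 𝕜 W]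
    (hW : ∀ g, ∀ x ∈ W, (ρ.toHom g : H →L[𝕜] H) x ∈ W) : GModule.{u} 𝕜 G where
  carrier := W
  action :=
    { toFun := fun g => ((ρ.toHom g : H →L[𝕜] H) : H →ₗ[𝕜] H).restrict (hW g)
      map_one' := by ext; simp
      map_mul' := fun g h => by ext; simp }
  continuous_coeff := fun v φ => by
    have h1 : Continuous φ := φ.continuous_of_finiteDimensional
    exact h1.comp ((ρ.continuous v).subtype_mk _)

/-- `(ker T)⁺ = ker T ∩ ker (γ - 1)`. -/
def kerPos (γ : H →L[𝕜] H) (T : H →ₗ.[𝕜] H) : Submodule 𝕜 H :=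
  opKer T ⊓ LinearMap.ker ((γ - 1 : H →L[𝕜] H) : H →ₗ[𝕜] H)

/-- `(ker T)⁻ = ker T ∩ ker (γ + 1)`. -/
def kerNeg (γ : H →L[𝕜] H) (T : H →ₗ.[𝕜] H) : Submodule 𝕜 H :=
  opKer T ⊓ LinearMap.ker ((γ + 1 : H →L[𝕜] H) : H →ₗ[𝕜] H)

variable {ρ : EvenUnitaryRep G γ}

lemma EvenUnitaryRep.even_apply (ρ : EvenUnitaryRep G γ) (g : G) (x : H) :
    γ ((ρ.toHom g : H →L[𝕜] H) x) = (ρ.toHom g : H →L[𝕜] H) (γ x) :=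
  (DFunLike.congr_fun (ρ.even g) x).symm

lemma kerPos_invariant (T : CFsaG ρ) (g : G) :
    ∀ x ∈ kerPos γ T.1.1, (ρ.toHom g : H →L[𝕜] H) x ∈ kerPos γ T.1.1 := by
  rintro x ⟨h1, h2⟩
  refine ⟨opKer_invariant (T.2.2.2 g) x h1, ?_⟩
  have h3 : γ x - x = 0 := h2
  change γ _ - (ρ.toHom g : H →L[𝕜] H) x = 0
  rw [ρ.even_apply, ← map_sub, h3, map_zero]

lemma kerNeg_invariant (T : CFsaG ρ) (g : G) :
    ∀ x ∈ kerNeg γ T.1.1, (ρ.toHom g : H →L[𝕜] H) x ∈ kerNeg γ T.1.1 := by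
  rintro x ⟨h1, h2⟩
  refine ⟨opKer_invariant (T.2.2.2 g) x h1, ?_⟩
  have h3 : γ x + x = 0 := h2
  change γ _ + (ρ.toHom g : H →L[𝕜] H) x = 0
  rw [ρ.even_apply, ← map_add, h3, map_zero]

/-- The `G`-index `ind_G T = [(ker T)⁺] - [(ker T)⁻] ∈ R(G)`. -/
def indG (ρ : EvenUnitaryRep G γ) (T : CFsaG ρ) : RepGroup.{u} 𝕜 G :=
  haveI : FiniteDimensional 𝕜 (opKer T.1.1) := T.2.1.finite_ker
  haveI : FiniteDimensional 𝕜 (kerPos γ T.1.1) := Submodule.finiteDimensional_inf_left _ _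
  haveI : FiniteDimensional 𝕜 (kerNeg γ T.1.1) := Submodule.finiteDimensional_inf_left _ _
  repClass (ρ.subrep (kerPos γ T.1.1) (kerPos_invariant T)) -
    repClass (ρ.subrep (kerNeg γ T.1.1) (kerNeg_invariant T))

end GIndex

/-! ### The Clifford index -/

section CliffordIndex

variable {𝕜 : Type*} [RCLike 𝕜] {H : Type u} [NormedAddCommGroup H] [InnerProductSpace 𝕜 H]
  [CompleteSpace H]

/-- A unital graded `*`-representation of the real algebra `Cℓ_n` by bounded operators on the
graded Hilbert space `(H, γ)`. -/
structure GradedClRep (n : ℕ) (γ : H →L[𝕜] H) where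
  toHom : Cl n →+* (H →L[𝕜] H)
  map_real : ∀ r : ℝ, toHom (algebraMap ℝ (Cl n) r) = (r : 𝕜) • (1 : H →L[𝕜] H)
  map_star : ∀ a, toHom (star a) = star (toHom a)
  graded : ∀ a, γ * toHom a = toHom (CliffordAlgebra.involute a) * γ

variable {n : ℕ} {γ : H →L[𝕜] H}

/-- The set of odd `Cℓ_n`-linear self-adjoint Fredholm operators in `H`. -/
def CFsaCl (ρ : GradedClRep n γ) : Set (SAOp 𝕜 H) :=
  {T | IsFredholm T.1 ∧ IsOdd γ T.1 ∧ ∀ a, OpCommutes T.1 (ρ.toHom a)}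

/-- A finite-dimensional `Cℓ_n`-invariant graded subspace, regarded as a real graded
`Cℓ_n`-module. -/
def GradedClRep.submodule (hγ : IsGrading γ) (ρ : GradedClRep n γ) (W : Submodule 𝕜 H)
    [FiniteDimensional 𝕜 W] (hW : ∀ a, ∀ x ∈ W, ρ.toHom a x ∈ W) (hW' : ∀ x ∈ W, γ x ∈ W) :
    GradedClModule.{u} n :=
  letI : Module ℝ W := Module.compHom W (algebraMap ℝ 𝕜)
  haveI : IsScalarTower ℝ 𝕜 W := ⟨fun r z w => by
    change (r • z) • w = (algebraMap ℝ 𝕜 r) • (z • w)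
    rw [Algebra.smul_def, mul_smul]⟩
  { carrier := W
    finite := FiniteDimensional.trans ℝ 𝕜 W
    action := AlgHom.ofLinearMap
      { toFun := fun a => (((ρ.toHom a : H →L[𝕜] H) : H →ₗ[𝕜] H).restrict (hW a)).restrictScalars ℝ
        map_add' := fun a b => by ext; simp
        map_smul' := fun r a => by
          refine LinearMap.ext fun w => Subtype.ext ?_
          change ρ.toHom (r • a) (w : H) = (algebraMap ℝ 𝕜 r) • ρ.toHom a (w : H)
          rw [Algebra.smul_def, map_mul, ρ.map_real]
          rfl }
      (by ext; simp) (fun a b => by ext; simp)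
    grading := ((γ : H →ₗ[𝕜] H).restrict hW').restrictScalars ℝ
    grading_sq := LinearMap.ext fun w => Subtype.ext (DFunLike.congr_fun hγ.sq (w : H))
    graded := fun a => LinearMap.ext fun w => Subtype.ext
      (DFunLike.congr_fun (ρ.graded a) (w : H)) }

/-- The Clifford index `ind_n T = [ker T] ∈ M̂_n / M̂_{n+1}`. -/
def indCl (hγ : IsGrading γ) (ρ : GradedClRep n γ) (T : CFsaCl ρ) : KOGroup.{u} n :=
  haveI : FiniteDimensional 𝕜 (opKer T.1.1) := T.2.1.finite_ker
  clClass (ρ.submodule hγ (opKer T.1.1) (fun a => opKer_invariant (T.2.2.2 a))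
    (opKer_invariant_of_odd T.2.2.1))

end CliffordIndex

end EquivariantIndex

end

open EquivariantIndex

noncomputable section

namespace EquivariantIndex

/-! ### Lyapunov–Schmidt reduction of a self-adjoint operator -/

section Reduction

variable {𝕜 : Type*} [RCLike 𝕜] {H : Type u} [NormedAddCommGroup H] [InnerProductSpace 𝕜 H]

/-! Fix `T₀`, let `V = ker T₀` and let `P` be the orthogonal projection onto `V`. Instead of
spectral projections, the proof uses a Lyapunov–Schmidt reduction carried out directly on graphs, so
real and complex scalars are treated alike. The map `(x, y) ↦ P x + (1 - P) y` is an isomorphism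
from the graph of `T₀` onto `H`, because `T₀` is Fredholm and self-adjoint
(`exists_bound_of_isFredholm`). Its lower bound survives a small change of the graph projection, and
for a self-adjoint operator a lower bound already forces surjectivity (`nonempty_reduction`,
`eventually_nonempty_reduction`). Hence for `T` near `T₀` every `v` determines a unique `(X v, S v)`
in the graph of `T` with `P (X v) = P v` and `S v ∈ V`.

The reduced operator `S` is symmetric with range in `V`, so `V = (V ∩ ker S) ⊕ range S`, and `P`
identifies `ker T` with `V ∩ ker S`. By uniqueness `S` inherits the symmetries of `T` and `T₀`: it
commutes with the group or the Clifford algebra and anticommutes with `γ`. All identifications are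
therefore equivariant, and `ker T₀` is `ker T` plus `range S`, on which `S` is invertible. It
remains to see that `range S` does not contribute.

For a group, `S` interchanges the even and odd parts of `range S` equivariantly, so their classes
cancel. For the Clifford algebra, the sign `F` of `S` is an odd Clifford linear involution
(`exists_sign`). Then `γ F` squares to `-1` and anticommutes with the generators, so it serves as
one more generator: `range S` is the restriction of a module over the next Clifford algebra and has
class zero. -/

/-- The map `(x, y) ↦ P x + (1 - P) y` on `H ⊕ H`, where `P` is the orthogonal projection
onto `V`. -/
def splitMap (V : Submodule 𝕜 H) [V.HasOrthogonalProjection] : WithLp 2 (H × H) →L[𝕜] H :=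
  (V.starProjection.comp (ContinuousLinearMap.fst 𝕜 H H) +
    (1 - V.starProjection).comp (ContinuousLinearMap.snd 𝕜 H H)).comp
      (WithLp.prodContinuousLinearEquiv 2 𝕜 H H).toContinuousLinearMap

lemma splitMap_apply (V : Submodule 𝕜 H) [V.HasOrthogonalProjection] (x y : H) :
    splitMap V (WithLp.toLp 2 (x, y)) = V.starProjection x + (y - V.starProjection y) := rfl

lemma starProjection_splitMap (V : Submodule 𝕜 H) [V.HasOrthogonalProjection] (x y : H) :
    V.starProjection (splitMap V (WithLp.toLp 2 (x, y))) = V.starProjection x := by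
  have h (z : H) : V.starProjection (V.starProjection z) = V.starProjection z :=
    Submodule.starProjection_eq_self_iff.2 (V.starProjection_apply_mem z)
  rw [splitMap_apply, map_add, map_sub, h, h, sub_self, add_zero]

lemma mem_graph_opKer {T : H →ₗ.[𝕜] H} {x : H} : x ∈ opKer T ↔ (x, (0 : H)) ∈ T.graph := by
  rw [mem_opKer, LinearPMap.mem_graph_iff]
  constructor
  · rintro ⟨h, hx⟩
    exact ⟨⟨x, h⟩, rfl, hx⟩
  · rintro ⟨y, rfl, hy⟩
    exact ⟨y.2, hy⟩

lemma OpCommutes.graph {T : H →ₗ.[𝕜] H} {A : H →L[𝕜] H} (h : OpCommutes T A) {x y : H}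
    (hxy : (x, y) ∈ T.graph) : (A x, A y) ∈ T.graph := by
  obtain ⟨z, rfl, rfl⟩ := (LinearPMap.mem_graph_iff _).1 hxy
  obtain ⟨h1, h2⟩ := h z
  rw [← h2]
  exact T.mem_graph ⟨_, h1⟩

lemma IsOdd.graph {T : H →ₗ.[𝕜] H} {γ : H →L[𝕜] H} (h : IsOdd γ T) {x y : H}
    (hxy : (x, y) ∈ T.graph) : (γ x, -γ y) ∈ T.graph := by
  obtain ⟨z, rfl, rfl⟩ := (LinearPMap.mem_graph_iff _).1 hxy
  obtain ⟨h1, h2⟩ := h z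
  rw [← h2]
  exact T.mem_graph ⟨_, h1⟩

variable [CompleteSpace H]

lemma mem_graphL2 {T : SAOp 𝕜 H} {x y : H} :
    WithLp.toLp 2 (x, y) ∈ graphL2 T.1 ↔ (x, y) ∈ T.1.graph := Iff.rfl

instance (T : SAOp 𝕜 H) : CompleteSpace (graphL2 T.1) := (isClosed_graphL2 T).completeSpace_coe

/-- The data of a reduction of `T` to the subspace `V`: for every `v`, the element
`(X v, S v)` is the only element `(x, y)` of the graph of `T` with `y ∈ V` and `P x = P v`. -/
structure Reduction (T : SAOp 𝕜 H) (V : Submodule 𝕜 H) [V.HasOrthogonalProjection] where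
  X : H →ₗ[𝕜] H
  S : H →ₗ[𝕜] H
  mem_graph : ∀ v, (X v, S v) ∈ T.1.graph
  proj_X : ∀ v, V.starProjection (X v) = V.starProjection v
  S_mem : ∀ v, S v ∈ V
  unique : ∀ x y v, (x, y) ∈ T.1.graph → y ∈ V → V.starProjection x = V.starProjection v →
    x = X v ∧ y = S v

/-- The bound gives injectivity and closed range. Surjectivity is free by self-adjointness: a vector
`z` orthogonal to the range yields an element of the graph killed by `splitMap`, and this element
determines `z`. -/
theorem nonempty_reduction {T : SAOp 𝕜 H} {V : Submodule 𝕜 H} [V.HasOrthogonalProjection]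
    {K : NNReal} (hK : ∀ z ∈ graphL2 T.1, ‖z‖ ≤ K * ‖splitMap V z‖) : Nonempty (Reduction T V) := by
  set f : graphL2 T.1 →L[𝕜] H := (splitMap V).comp (graphL2 T.1).subtypeL with hf
  have hanti : AntilipschitzWith K f := f.antilipschitz_of_bound fun z => hK z z.2
  have hinj : Function.Injective f := hanti.injective
  have hcl : IsClosed (LinearMap.range (f : graphL2 T.1 →ₗ[𝕜] H) : Set H) :=
    hanti.isClosed_range f.uniformContinuous
  have hsurj : LinearMap.range (f : graphL2 T.1 →ₗ[𝕜] H) = ⊤ := by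
    have := hcl.completeSpace_coe
    rw [← Submodule.orthogonal_eq_bot_iff, Submodule.eq_bot_iff]
    intro z hz
    -- Moving `P` to the other side, orthogonality of `z` to all `P a + (1 - P) b` is exactly the
    -- adjoint graph condition for this pair.
    have key : (z - V.starProjection z, -V.starProjection z) ∈ T.1.graph := by
      refine mem_graph_of_forall fun a b hab => ?_
      have h := (Submodule.mem_orthogonal _ _).1 hz _ ⟨⟨WithLp.toLp 2 (a, b), hab⟩, rfl⟩
      change inner 𝕜 (V.starProjection a + (b - V.starProjection b)) z = 0 at h
      simp only [inner_add_left, inner_sub_left, Submodule.inner_starProjection_left_eq_right] at h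
      rw [inner_sub_right, inner_neg_right]
      linear_combination h
    have h0 : splitMap V (WithLp.toLp 2 (z - V.starProjection z, -V.starProjection z)) = 0 := by
      have h (z : H) : V.starProjection (V.starProjection z) = V.starProjection z :=
        Submodule.starProjection_eq_self_iff.2 (V.starProjection_apply_mem z)
      rw [splitMap_apply, map_sub, map_neg, h]
      simp
    have h1 := hK _ (mem_graphL2.2 key)
    rw [h0, norm_zero, mul_zero, norm_le_zero_iff, WithLp.toLp_eq_zero, Prod.mk_eq_zero,
      neg_eq_zero] at h1
    rw [← sub_add_cancel z (V.starProjection z), h1.1, h1.2, add_zero]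
  set e : graphL2 T.1 ≃ₗ[𝕜] H := LinearEquiv.ofBijective (f : graphL2 T.1 →ₗ[𝕜] H)
    ⟨hinj, LinearMap.range_eq_top.1 hsurj⟩ with he
  -- The equation is solved for `P v`, not `v`: then `(1 - P) y = 0`, which puts `y` in `V`.
  set j : H →ₗ[𝕜] H × H := (WithLp.linearEquiv 2 𝕜 (H × H)).toLinearMap ∘ₗ
    (graphL2 T.1).subtype ∘ₗ e.symm.toLinearMap ∘ₗ (V.starProjection : H →ₗ[𝕜] H) with hj
  have hjs (v : H) : splitMap V (WithLp.toLp 2 (j v)) = V.starProjection v :=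
    e.apply_symm_apply (V.starProjection v)
  have hP (z : H) : V.starProjection (V.starProjection z) = V.starProjection z :=
    Submodule.starProjection_eq_self_iff.2 (V.starProjection_apply_mem z)
  have hjP (v : H) : V.starProjection (j v).1 = V.starProjection v := by
    have h := starProjection_splitMap V (j v).1 (j v).2
    rw [hjs, hP] at h
    exact h.symm
  refine ⟨⟨LinearMap.fst 𝕜 H H ∘ₗ j, LinearMap.snd 𝕜 H H ∘ₗ j,
    fun v => (e.symm (V.starProjection v)).2, hjP, fun v => ?_, fun x y v hxy hy hx => ?_⟩⟩
  · have h := hjs v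
    change splitMap V (WithLp.toLp 2 ((j v).1, (j v).2)) = _ at h
    rw [splitMap_apply, hjP, add_eq_left, sub_eq_zero] at h
    exact Submodule.starProjection_eq_self_iff.1 h.symm
  · have h : e ⟨WithLp.toLp 2 (x, y), hxy⟩ = V.starProjection v := by
      change splitMap V (WithLp.toLp 2 (x, y)) = _
      rw [splitMap_apply, Submodule.starProjection_eq_self_iff.2 hy, sub_self, add_zero, hx]
    have h2 : j v = (x, y) := by
      change WithLp.ofLp ((e.symm (V.starProjection v) : graphL2 T.1) : WithLp 2 (H × H)) = _
      rw [← h, LinearEquiv.symm_apply_apply]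
    simp [h2]

lemma starProjection_opKer_of_graph {T : SAOp 𝕜 H} [(opKer T.1).HasOrthogonalProjection]
    {x y : H} (h : (x, y) ∈ T.1.graph) : (opKer T.1).starProjection y = 0 := by
  refine Submodule.eq_starProjection_of_mem_of_inner_eq_zero (zero_mem _) fun w hw => ?_
  rw [sub_zero, graph_symm h (mem_graph_opKer.1 hw), inner_zero_right]

/-- If `z` is orthogonal to the range, then `(z, 0)` lies in the adjoint graph, so `z` is in the
kernel. Taking complements, closedness turns the double complement back into the range. -/
lemma orthogonal_opKer_le {T : SAOp 𝕜 H} (hT : IsClosed (opRange T.1 : Set H)) :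
    (opKer T.1)ᗮ ≤ opRange T.1 := by
  have := hT.completeSpace_coe
  rw [← (opRange T.1).orthogonal_orthogonal]
  refine Submodule.orthogonal_le fun z hz => mem_graph_opKer.2 (mem_graph_of_forall ?_)
  intro a b hab
  obtain ⟨x, rfl, rfl⟩ := (LinearPMap.mem_graph_iff _).1 hab
  rw [inner_zero_right]
  exact (Submodule.mem_orthogonal _ _).1 hz _ ⟨x, rfl⟩

/-- On the graph `y` is orthogonal to the kernel, so `splitMap` becomes the orthogonal sum `P x +
y`. It is bijective there, and the open mapping theorem gives the constant. -/
theorem exists_bound_of_isFredholm {T : SAOp 𝕜 H} (hT : IsFredholm T.1)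
    [(opKer T.1).HasOrthogonalProjection] :
    ∃ K : NNReal, ∀ z ∈ graphL2 T.1, ‖z‖ ≤ K * ‖splitMap (opKer T.1) z‖ := by
  set f : graphL2 T.1 →L[𝕜] H := (splitMap (opKer T.1)).comp (graphL2 T.1).subtypeL with hf
  have hP (z : H) : (opKer T.1).starProjection ((opKer T.1).starProjection z) =
      (opKer T.1).starProjection z :=
    Submodule.starProjection_eq_self_iff.2 ((opKer T.1).starProjection_apply_mem z)
  have hker : LinearMap.ker (f : graphL2 T.1 →ₗ[𝕜] H) = ⊥ := by
    rw [LinearMap.ker_eq_bot']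
    rintro ⟨⟨x, y⟩, hz⟩ h
    change splitMap _ (WithLp.toLp 2 (x, y)) = 0 at h
    have h1 := starProjection_splitMap (opKer T.1) x y
    rw [h, map_zero] at h1
    have h2 : y = 0 := by
      rw [splitMap_apply, ← h1, starProjection_opKer_of_graph (mem_graphL2.1 hz)] at h
      simpa using h
    subst h2
    have h3 := Submodule.starProjection_eq_self_iff.2 (mem_graph_opKer.2 (mem_graphL2.1 hz))
    rw [← h1] at h3
    subst h3
    rfl
  have hrange : LinearMap.range (f : graphL2 T.1 →ₗ[𝕜] H) = ⊤ := by
    rw [LinearMap.range_eq_top]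
    intro z
    obtain ⟨a, ha⟩ := orthogonal_opKer_le hT.closed_range
      ((opKer T.1).sub_starProjection_mem_orthogonal z)
    have hg : ((a : H), z - (opKer T.1).starProjection z) ∈ T.1.graph := by
      rw [← ha]; exact T.1.mem_graph a
    -- A correction in the kernel, changing the `P`-component of the preimage from `P a` to `P z`
    -- without affecting the second entry.
    have hk : ((opKer T.1).starProjection (z - a), (0 : H)) ∈ T.1.graph :=
      mem_graph_opKer.1 ((opKer T.1).starProjection_apply_mem _)
    refine ⟨⟨WithLp.toLp 2 ((a : H) + (opKer T.1).starProjection (z - a),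
      (z - (opKer T.1).starProjection z) + 0), T.1.graph.add_mem hg hk⟩, ?_⟩
    change splitMap _ (WithLp.toLp 2 (_, _)) = z
    rw [splitMap_apply]
    simp only [map_add, map_sub, hP, map_zero]
    abel
  set e := ContinuousLinearEquiv.ofBijective f hker hrange with he
  refine ⟨‖(e.symm : H →L[𝕜] graphL2 T.1)‖₊, fun z hz => ?_⟩
  have h := (e.symm : H →L[𝕜] graphL2 T.1).le_opNorm (e ⟨z, hz⟩)
  rw [ContinuousLinearEquiv.coe_coe, e.symm_apply_apply] at h
  exact h

theorem eventually_nonempty_reduction {T₀ : SAOp 𝕜 H} (hT₀ : IsFredholm T₀.1)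
    [(opKer T₀.1).HasOrthogonalProjection] :
    ∀ᶠ T in nhds T₀, Nonempty (Reduction T (opKer T₀.1)) := by
  obtain ⟨K, hK⟩ := exists_bound_of_isFredholm hT₀
  -- With `w` the projection of `z` to the graph of `T₀`, one has `‖z‖ ≤ C ‖z - w‖ + K ‖splitMap
  -- z‖`. Radius `1 / (2C)` makes the first term at most `‖z‖ / 2`, whence the bound `2K`.
  set C : ℝ := 1 + K * ‖splitMap (opKer T₀.1)‖ with hC
  have hCpos : 0 < C := by positivity
  filter_upwards [Metric.ball_mem_nhds T₀ (show 0 < 1 / (2 * C) by positivity)] with T hT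
  refine nonempty_reduction (K := 2 * K) fun z hz => ?_
  have hd : ‖graphProj T - graphProj T₀‖ < 1 / (2 * C) := by
    rw [← dist_eq_norm]; exact hT
  set w := graphProj T₀ z with hw
  have hzw : ‖z - w‖ ≤ 1 / (2 * C) * ‖z‖ := by
    have h1 : z = graphProj T z := (Submodule.starProjection_eq_self_iff.2 hz).symm
    have h2 : z - w = (graphProj T - graphProj T₀) z := by
      rw [sub_apply, ← h1]
    rw [h2]
    exact ((graphProj T - graphProj T₀).le_opNorm z).trans
      (mul_le_mul_of_nonneg_right hd.le (norm_nonneg _))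
  have hw1 := hK w ((graphL2 T₀.1).starProjection_apply_mem z)
  have h3 : ‖splitMap (opKer T₀.1) w‖ ≤ ‖splitMap (opKer T₀.1) z‖ +
      ‖splitMap (opKer T₀.1)‖ * ‖z - w‖ := by
    have := norm_sub_le (splitMap (opKer T₀.1) z) (splitMap (opKer T₀.1) (z - w))
    rw [← map_sub, sub_sub_cancel] at this
    exact this.trans (by gcongr; exact ContinuousLinearMap.le_opNorm _ _)
  have h4 : ‖z‖ ≤ ‖z - w‖ + ‖w‖ := by simpa using norm_add_le (z - w) w
  have h5 : C * ‖z - w‖ ≤ ‖z‖ / 2 := by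
    calc C * ‖z - w‖ ≤ C * (1 / (2 * C) * ‖z‖) := mul_le_mul_of_nonneg_left hzw hCpos.le
      _ = ‖z‖ / 2 := by field_simp
  have h6 := mul_le_mul_of_nonneg_left h3 K.coe_nonneg
  push_cast
  rw [hC] at h5
  nlinarith

/-! ### Symmetry, equivariance and kernel of the reduced operator -/

namespace Reduction

variable {T : SAOp 𝕜 H} {V : Submodule 𝕜 H} [V.HasOrthogonalProjection] (r : Reduction T V)

/-- Since `S v ∈ V` and `P w = P (X w)`, pairing `S v` with `w` is pairing it with `X w`, where the
symmetry of `T` applies. -/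
lemma S_symm (v w : H) : inner 𝕜 (r.S v) w = inner 𝕜 v (r.S w) := by
  have h (v w : H) : inner 𝕜 (r.S v) w = inner 𝕜 (r.S v) (r.X w) := by
    rw [← Submodule.starProjection_eq_self_iff.2 (r.S_mem v),
      Submodule.inner_starProjection_left_eq_right, ← r.proj_X w,
      ← Submodule.inner_starProjection_left_eq_right]
  rw [h, graph_symm (r.mem_graph v) (r.mem_graph w), ← inner_conj_symm, ← h, inner_conj_symm]

lemma isSymmetric : r.S.IsSymmetric := r.S_symm

/-- The uniqueness clause applied to `(A (X v), B (S v))`. Separate operators on the two entries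
allow for the odd case `A = γ`, `B = -γ`. -/
lemma map_X_S {A B : H →L[𝕜] H} (hAB : ∀ x y, (x, y) ∈ T.1.graph → (A x, B y) ∈ T.1.graph)
    (hA : ∀ x, V.starProjection (A x) = A (V.starProjection x)) (hB : ∀ x ∈ V, B x ∈ V) (v : H) :
    A (r.X v) = r.X (A v) ∧ B (r.S v) = r.S (A v) := by
  refine r.unique _ _ (A v) (hAB _ _ (r.mem_graph v)) (hB _ (r.S_mem v)) ?_
  rw [hA, hA, r.proj_X]

/-- The kernel of the reduced operator. -/
def kerS : Submodule 𝕜 H := V ⊓ LinearMap.ker r.S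

/-- For `x` in the kernel, `(x, 0)` is already the solution belonging to `P x`. -/
lemma opKer_proj_mem {x : H} (hx : x ∈ opKer T.1) : V.starProjection x ∈ r.kerS := by
  refine ⟨V.starProjection_apply_mem x, ?_⟩
  exact (r.unique x 0 _ (mem_graph_opKer.1 hx) (zero_mem _)
    (Submodule.starProjection_eq_self_iff.2 (V.starProjection_apply_mem x)).symm).2.symm

lemma eq_zero_of_proj_eq_zero (r : Reduction T V) {x : H} (hx : x ∈ opKer T.1)
    (h : V.starProjection x = 0) :
    x = 0 := by
  have := (r.unique x 0 0 (mem_graph_opKer.1 hx) (zero_mem _) (by rw [h, map_zero])).1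
  rwa [map_zero] at this

lemma X_mem_opKer {v : H} (hv : v ∈ LinearMap.ker r.S) : r.X v ∈ opKer T.1 := by
  have h := r.mem_graph v
  rw [LinearMap.mem_ker.1 hv] at h
  exact mem_graph_opKer.2 h

lemma proj_X_of_mem {v : H} (hv : v ∈ V) : V.starProjection (r.X v) = v :=
  (r.proj_X v).trans (Submodule.starProjection_eq_self_iff.2 hv)

lemma range_le : LinearMap.range r.S ≤ V := by
  rintro _ ⟨v, rfl⟩
  exact r.S_mem v

lemma ker_inf_range : r.kerS ⊓ LinearMap.range r.S = ⊥ := by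
  rw [kerS, ← r.isSymmetric.orthogonal_range, inf_assoc,
    inf_comm (a := (LinearMap.range r.S)ᗮ), Submodule.inf_orthogonal_eq_bot, inf_bot_eq]

lemma ker_sup_range [FiniteDimensional 𝕜 V] :
    r.kerS ⊔ LinearMap.range r.S = V := by
  have := Submodule.finiteDimensional_of_le r.range_le
  rw [sup_comm, kerS, inf_comm, ← r.isSymmetric.orthogonal_range]
  exact Submodule.sup_orthogonal_inf_of_hasOrthogonalProjection r.range_le

end Reduction

/-- Invariance of `V` under the adjoint makes the orthogonal complement invariant under `A`. -/
lemma starProjection_comm {V : Submodule 𝕜 H} [V.HasOrthogonalProjection] {A : H →L[𝕜] H}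
    (h : ∀ x ∈ V, A x ∈ V) (h' : ∀ x ∈ V, star A x ∈ V) (x : H) :
    V.starProjection (A x) = A (V.starProjection x) := by
  refine Submodule.eq_starProjection_of_mem_of_inner_eq_zero
    (h _ (V.starProjection_apply_mem x)) fun w hw => ?_
  rw [← map_sub, ← ContinuousLinearMap.adjoint_inner_right]
  exact V.starProjection_inner_eq_zero x _ (h' w hw)

end Reduction

/-! ### Decompositions of invariant subspaces -/

section Algebra

variable {𝕜 : Type*} [RCLike 𝕜] {H : Type u} [NormedAddCommGroup H] [InnerProductSpace 𝕜 H]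

/-- If `B` kills `k + l`, then `B k = -B l` lies in both subspaces and vanishes. With `B = γ ∓ 1`
this splits the even and odd parts of `V`. -/
lemma sup_inf_ker {K R : Submodule 𝕜 H} (B : H →ₗ[𝕜] H) (hKR : K ⊓ R = ⊥)
    (hK : ∀ x ∈ K, B x ∈ K) (hR : ∀ x ∈ R, B x ∈ R) :
    (K ⊓ LinearMap.ker B) ⊔ (R ⊓ LinearMap.ker B) = (K ⊔ R) ⊓ LinearMap.ker B := by
  apply le_antisymm
  · exact sup_le (inf_le_inf_right _ le_sup_left) (inf_le_inf_right _ le_sup_right)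
  · rintro x ⟨hx, hBx⟩
    obtain ⟨k, hk, l, hl, rfl⟩ := Submodule.mem_sup.1 hx
    replace hBx : B k + B l = 0 := by rw [← map_add]; exact hBx
    have h : B k ∈ K ⊓ R :=
      ⟨hK k hk, by rw [eq_neg_of_add_eq_zero_left hBx]; exact neg_mem (hR l hl)⟩
    rw [hKR, Submodule.mem_bot] at h
    rw [h, zero_add] at hBx
    exact Submodule.add_mem_sup ⟨hk, h⟩ ⟨hl, hBx⟩

lemma inf_inf_eq_bot {K R : Submodule 𝕜 H} (E : Submodule 𝕜 H) (hKR : K ⊓ R = ⊥) :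
    (K ⊓ E) ⊓ (R ⊓ E) = ⊥ :=
  le_bot_iff.1 (hKR ▸ inf_le_inf inf_le_left inf_le_left)

/-- The addition map `K × R → K + R` for independent subspaces. -/
def addEquiv {K R W : Submodule 𝕜 H} (h : K ⊓ R = ⊥) (h' : K ⊔ R = W) : (K × R) ≃ₗ[𝕜] W :=
  LinearEquiv.ofBijective
    ((K.subtype.coprod R.subtype).codRestrict W fun x =>
      h' ▸ Submodule.add_mem_sup x.1.2 x.2.2) (by
    constructor
    · rw [injective_iff_map_eq_zero]
      rintro ⟨⟨k, hk⟩, ⟨l, hl⟩⟩ hx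
      have hx' : k + l = 0 := congrArg Subtype.val hx
      have hk' : k ∈ K ⊓ R := ⟨hk, by rw [eq_neg_of_add_eq_zero_left hx']; exact neg_mem hl⟩
      rw [h, Submodule.mem_bot] at hk'
      subst hk'
      rw [zero_add] at hx'
      subst hx'
      rfl
    · rintro ⟨x, hx⟩
      obtain ⟨k, hk, l, hl, rfl⟩ := Submodule.mem_sup.1 (h' ▸ hx)
      exact ⟨(⟨k, hk⟩, ⟨l, hl⟩), rfl⟩)

/-- The isomorphism `U ≃ W` induced by an operator of `H`. -/
def restrictEquiv {U W : Submodule 𝕜 H} (A : H →ₗ[𝕜] H) (hmap : ∀ x ∈ U, A x ∈ W)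
    (hinj : ∀ x ∈ U, A x = 0 → x = 0) (hsurj : ∀ y ∈ W, ∃ x ∈ U, A x = y) : U ≃ₗ[𝕜] W :=
  LinearEquiv.ofBijective (A.restrict hmap) (by
    constructor
    · rw [injective_iff_map_eq_zero]
      rintro ⟨x, hx⟩ h
      exact Subtype.ext (hinj x hx (congrArg Subtype.val h))
    · rintro ⟨y, hy⟩
      obtain ⟨x, hx, rfl⟩ := hsurj y hy
      exact ⟨⟨x, hx⟩, rfl⟩)

end Algebra

/-! ### Classes of representations in `H` -/

section RepClass

variable {𝕜 : Type*} [RCLike 𝕜] {H : Type u} [NormedAddCommGroup H] [InnerProductSpace 𝕜 H]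
  [CompleteSpace H] {G : Type*} [Group G] [TopologicalSpace G] {γ : H →L[𝕜] H}

lemma repClass_eq_of_equivalent {V W : GModule.{u} 𝕜 G} (h : V.Equivalent W) :
    repClass V = repClass W :=
  congrArg (fun c : GModuleClass.{u} 𝕜 G => Algebra.GrothendieckAddGroup.of c) (Quotient.sound h)

lemma repClass_directSum (V W : GModule.{u} 𝕜 G) :
    repClass (V.directSum W) = repClass V + repClass W :=
  AddMonoidHom.map_add (Algebra.GrothendieckAddGroup.of (M := GModuleClass.{u} 𝕜 G))
    (show GModuleClass.{u} 𝕜 G from Quotient.mk _ V) (Quotient.mk _ W)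

lemma repClass_subrep_congr (ρ : EvenUnitaryRep G γ) {U W : Submodule 𝕜 H}
    [FiniteDimensional 𝕜 U] [FiniteDimensional 𝕜 W]
    (hU : ∀ g, ∀ x ∈ U, (ρ.toHom g : H →L[𝕜] H) x ∈ U)
    (hW : ∀ g, ∀ x ∈ W, (ρ.toHom g : H →L[𝕜] H) x ∈ W) (e : U ≃ₗ[𝕜] W)
    (he : ∀ g (x : U), (e ⟨_, hU g x x.2⟩ : H) = (ρ.toHom g : H →L[𝕜] H) (e x)) :
    repClass (ρ.subrep U hU) = repClass (ρ.subrep W hW) :=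
  repClass_eq_of_equivalent ⟨e, fun g x => Subtype.ext (he g x)⟩

lemma repClass_subrep_add (ρ : EvenUnitaryRep G γ) {K R W : Submodule 𝕜 H}
    [FiniteDimensional 𝕜 K] [FiniteDimensional 𝕜 R] [FiniteDimensional 𝕜 W]
    (hK : ∀ g, ∀ x ∈ K, (ρ.toHom g : H →L[𝕜] H) x ∈ K)
    (hR : ∀ g, ∀ x ∈ R, (ρ.toHom g : H →L[𝕜] H) x ∈ R)
    (hW : ∀ g, ∀ x ∈ W, (ρ.toHom g : H →L[𝕜] H) x ∈ W) (h : K ⊓ R = ⊥) (h' : K ⊔ R = W) :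
    repClass (ρ.subrep W hW) = repClass (ρ.subrep K hK) + repClass (ρ.subrep R hR) := by
  rw [← repClass_directSum]
  refine (repClass_eq_of_equivalent ⟨addEquiv h h', fun g x => Subtype.ext ?_⟩).symm
  exact (map_add (ρ.toHom g : H →L[𝕜] H) (x.1.1 : H) (x.2.1 : H)).symm

end RepClass

/-! ### Classes of graded Clifford modules -/

section CliffordClass

lemma clClass_eq_of_equivalent {n : ℕ} {V W : GradedClModule.{u} n} (h : V.Equivalent W) :
    clClass V = clClass W :=
  congrArg (fun c : GradedClModuleClass.{u} n => (QuotientAddGroup.mk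
    (Algebra.GrothendieckAddGroup.of c) : KOGroup.{u} n)) (Quotient.sound h)

lemma clClass_directSum {n : ℕ} (V W : GradedClModule.{u} n) :
    clClass (V.directSum W) = clClass V + clClass W :=
  AddMonoidHom.map_add ((QuotientAddGroup.mk' (restrictHom.{u} n).range).comp
    (Algebra.GrothendieckAddGroup.of (M := GradedClModuleClass.{u} n)))
    (show GradedClModuleClass.{u} n from Quotient.mk _ V) (Quotient.mk _ W)

lemma clClass_restrict {n : ℕ} (V : GradedClModule.{u} (n + 1)) : clClass V.restrict = 0 := by
  rw [clClass, QuotientAddGroup.eq_zero_iff]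
  refine ⟨Algebra.GrothendieckAddGroup.of (Quotient.mk _ V : GradedClModuleClass.{u} (n + 1)), ?_⟩
  exact DFunLike.congr_fun (Algebra.GrothendieckAddGroup.lift.symm_apply_apply
    (Algebra.GrothendieckAddGroup.of.comp (restrictClass.{u} n))) (Quotient.mk _ V)

/-! ### Extending a graded module by one Clifford generator -/

namespace GradedClModule

variable {n : ℕ} (V : GradedClModule.{u} n) {F : Module.End ℝ V.carrier}

lemma grading_mul_ι (x : Fin n → ℝ) :
    V.grading * V.action (CliffordAlgebra.ι _ x) =
      -(V.action (CliffordAlgebra.ι _ x) * V.grading) := by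
  rw [V.graded, CliffordAlgebra.involute_ι, map_neg, neg_mul]

/-- The vectors of `ℝⁿ⁺¹` acting on a graded `Cℓ_n`-module with a Clifford linear odd
endomorphism `F`, where the last basis vector acts by `γ F`. -/
def extendVec (F : Module.End ℝ V.carrier) : (Fin (n + 1) → ℝ) →ₗ[ℝ] Module.End ℝ V.carrier :=
  V.action.toLinearMap ∘ₗ CliffordAlgebra.ι (negForm n) ∘ₗ LinearMap.funLeft ℝ ℝ Fin.castSucc +
    (LinearMap.proj (Fin.last n)).smulRight (V.grading * F)

lemma extendVec_apply (F : Module.End ℝ V.carrier) (x : Fin (n + 1) → ℝ) :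
    V.extendVec F x = V.action (CliffordAlgebra.ι (negForm n) (x ∘ Fin.castSucc)) +
      x (Fin.last n) • (V.grading * F) := rfl

/-- By itself `F` has the wrong signs: it squares to `1` and commutes with the old generators. The
factor `γ` corrects both, so the cross terms cancel and the new square is `-1`. -/
lemma extendVec_sq (hF : F * F = 1) (hodd : V.grading * F = -(F * V.grading))
    (hcomm : ∀ a, F * V.action a = V.action a * F) (x : Fin (n + 1) → ℝ) :
    V.extendVec F x * V.extendVec F x = algebraMap ℝ _ (negForm (n + 1) x) := by
  set y := x ∘ Fin.castSucc with hy
  set a := V.action (CliffordAlgebra.ι (negForm n) y) with ha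
  set t := x (Fin.last n) with ht
  have haa : a * a = algebraMap ℝ _ (negForm n y) := by
    rw [ha, ← map_mul, CliffordAlgebra.ι_sq_scalar, AlgHom.commutes]
  have hJJ : V.grading * F * (V.grading * F) = -1 := by
    calc V.grading * F * (V.grading * F) = -(V.grading * F * (F * V.grading)) := by
          rw [hodd]; noncomm_ring
      _ = -(V.grading * (F * F) * V.grading) := by noncomm_ring
      _ = -1 := by rw [hF, mul_one, V.grading_sq]
  have haJ : V.grading * F * a = -(a * (V.grading * F)) := by
    rw [mul_assoc, hcomm, ← mul_assoc, V.grading_mul_ι, neg_mul, mul_assoc]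
  have hQ : negForm (n + 1) x = negForm n y - t * t := by
    simp [negForm, QuadraticMap.weightedSumSquares_apply, Fin.sum_univ_castSucc, hy, ht,
      sub_eq_add_neg, add_comm]
  rw [extendVec_apply, hQ, map_sub, ← haa, add_mul, mul_add, mul_add, mul_smul_comm, smul_mul_assoc,
    haJ, smul_mul_smul_comm, hJJ, Algebra.algebraMap_eq_smul_one]
  simp only [smul_neg]
  abel

/-- The graded `Cℓ_{n+1}`-module structure on a graded `Cℓ_n`-module given by an odd Clifford linear
involution. -/
def extend (hF : F * F = 1) (hodd : V.grading * F = -(F * V.grading))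
    (hcomm : ∀ a, F * V.action a = V.action a * F) : GradedClModule.{u} (n + 1) where
  carrier := V.carrier
  action := CliffordAlgebra.lift (negForm (n + 1)) ⟨V.extendVec F, V.extendVec_sq hF hodd hcomm⟩
  grading := V.grading
  grading_sq := V.grading_sq
  graded a := by
    induction a using CliffordAlgebra.induction with
    | algebraMap r => rw [AlgHom.commutes, AlgHom.commutes, AlgHom.commutes, Algebra.commutes]
    | ι x =>
      rw [CliffordAlgebra.involute_ι, map_neg, CliffordAlgebra.lift_ι_apply, extendVec_apply,
        mul_add, V.grading_mul_ι, mul_smul_comm, neg_mul, add_mul, smul_mul_assoc, neg_add,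
        mul_assoc V.grading F, ← neg_eq_iff_eq_neg.2 hodd, mul_neg, smul_neg, neg_neg]
    | mul a b ha hb => rw [map_mul, map_mul, map_mul, ← mul_assoc, ha, mul_assoc, hb, mul_assoc]
    | add a b ha hb => rw [map_add, map_add, map_add, mul_add, add_mul, ha, hb]

lemma extend_restrict (hF : F * F = 1) (hodd : V.grading * F = -(F * V.grading))
    (hcomm : ∀ a, F * V.action a = V.action a * F) :
    (V.extend hF hodd hcomm).restrict.Equivalent V := by
  have h : (CliffordAlgebra.lift (negForm (n + 1))
      ⟨V.extendVec F, V.extendVec_sq hF hodd hcomm⟩).comp (clIncl n) = V.action := by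
    refine CliffordAlgebra.hom_ext (LinearMap.ext fun x => ?_)
    have h1 : negFormIncl n x ∘ Fin.castSucc = x :=
      funext fun i => Fin.snoc_castSucc (α := fun _ => ℝ) 0 x i
    have h2 : negFormIncl n x (Fin.last n) = 0 := Fin.snoc_last (α := fun _ => ℝ) 0 x
    simp only [LinearMap.comp_apply, AlgHom.toLinearMap_apply, AlgHom.comp_apply, clIncl,
      CliffordAlgebra.map_apply_ι, CliffordAlgebra.lift_ι_apply]
    rw [extendVec_apply, h1, h2, zero_smul, add_zero]
  exact ⟨LinearEquiv.refl ℝ _, fun a v => LinearMap.congr_fun (DFunLike.congr_fun h a) v,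
    fun _ => rfl⟩

lemma clClass_eq_zero (hF : F * F = 1) (hodd : V.grading * F = -(F * V.grading))
    (hcomm : ∀ a, F * V.action a = V.action a * F) : clClass V = 0 := by
  rw [← clClass_eq_of_equivalent (V.extend_restrict hF hodd hcomm), clClass_restrict]

end GradedClModule

/-! ### Graded Clifford submodules of `H` -/

variable {𝕜 : Type*} [RCLike 𝕜] {H : Type u} [NormedAddCommGroup H] [InnerProductSpace 𝕜 H]
  [CompleteSpace H] {n : ℕ} {γ : H →L[𝕜] H}

lemma clClass_submodule_congr (hγ : IsGrading γ) (ρ : GradedClRep n γ) {U W : Submodule 𝕜 H}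
    [FiniteDimensional 𝕜 U] [FiniteDimensional 𝕜 W]
    (hU : ∀ a, ∀ x ∈ U, ρ.toHom a x ∈ U) (hU' : ∀ x ∈ U, γ x ∈ U)
    (hW : ∀ a, ∀ x ∈ W, ρ.toHom a x ∈ W) (hW' : ∀ x ∈ W, γ x ∈ W) (e : U ≃ₗ[𝕜] W)
    (he : ∀ a (x : U), (e ⟨_, hU a x x.2⟩ : H) = ρ.toHom a (e x))
    (he' : ∀ x : U, (e ⟨_, hU' x x.2⟩ : H) = γ (e x)) :
    clClass (ρ.submodule hγ U hU hU') = clClass (ρ.submodule hγ W hW hW') := by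
  refine clClass_eq_of_equivalent ⟨?_, ?_⟩
  -- The real structure is defined by `algebraMap ℝ 𝕜`, so real linearity is a case of
  -- `𝕜`-linearity.
  · exact { e.toAddEquiv with map_smul' := fun r x => e.map_smul (algebraMap ℝ 𝕜 r) x }
  · exact ⟨fun a x => Subtype.ext (he a x), fun x => Subtype.ext (he' x)⟩

lemma clClass_submodule_add (hγ : IsGrading γ) (ρ : GradedClRep n γ) {K R W : Submodule 𝕜 H}
    [FiniteDimensional 𝕜 K] [FiniteDimensional 𝕜 R] [FiniteDimensional 𝕜 W]
    (hK : ∀ a, ∀ x ∈ K, ρ.toHom a x ∈ K) (hK' : ∀ x ∈ K, γ x ∈ K)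
    (hR : ∀ a, ∀ x ∈ R, ρ.toHom a x ∈ R) (hR' : ∀ x ∈ R, γ x ∈ R)
    (hW : ∀ a, ∀ x ∈ W, ρ.toHom a x ∈ W) (hW' : ∀ x ∈ W, γ x ∈ W)
    (h : K ⊓ R = ⊥) (h' : K ⊔ R = W) :
    clClass (ρ.submodule hγ W hW hW') =
      clClass (ρ.submodule hγ K hK hK') + clClass (ρ.submodule hγ R hR hR') := by
  rw [← clClass_directSum]
  refine (clClass_eq_of_equivalent ⟨?_, ?_⟩).symm
  · exact { (addEquiv h h').toAddEquiv with
      map_smul' := fun r x => (addEquiv h h').map_smul (algebraMap ℝ 𝕜 r) x }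
  · exact ⟨fun a x => Subtype.ext (map_add (ρ.toHom a) (x.1.1 : H) (x.2.1 : H)).symm,
      fun x => Subtype.ext (map_add γ (x.1.1 : H) (x.2.1 : H)).symm⟩

lemma clClass_submodule_eq_zero (hγ : IsGrading γ) (ρ : GradedClRep n γ) {R : Submodule 𝕜 H}
    [FiniteDimensional 𝕜 R] (hR : ∀ a, ∀ x ∈ R, ρ.toHom a x ∈ R) (hR' : ∀ x ∈ R, γ x ∈ R)
    (F : R →ₗ[𝕜] R) (hF : ∀ x, F (F x) = x) (hodd : ∀ x : R, γ (F x) = -(F ⟨_, hR' x x.2⟩ : H))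
    (hcomm : ∀ a (x : R), (F ⟨_, hR a x x.2⟩ : H) = ρ.toHom a (F x)) :
    clClass (ρ.submodule hγ R hR hR') = 0 := by
  refine (ρ.submodule hγ R hR hR').clClass_eq_zero
    (F := { F.toAddMonoidHom with map_smul' := fun r x => F.map_smul (algebraMap ℝ 𝕜 r) x }) ?_ ?_ ?_
  · exact LinearMap.ext fun x => hF x
  · exact LinearMap.ext fun x => Subtype.ext (hodd x)
  · exact fun a => LinearMap.ext fun x => Subtype.ext (hcomm a x)

end CliffordClass

/-! ### The sign of an invertible symmetric operator -/

section Sign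

variable {𝕜 : Type*} [RCLike 𝕜] {E : Type*} [NormedAddCommGroup E] [InnerProductSpace 𝕜 E]
  [FiniteDimensional 𝕜 E]

-- In an eigenbasis take `p (λ²) = 1 / |λ|` by interpolation; then `p (S²) S` has eigenvalues `λ /
-- |λ|`. An odd polynomial in `S` is needed so that anticommutation with `γ` is inherited.
open Polynomial in
theorem exists_polynomial_sign {S : Module.End 𝕜 E} (hS : S.IsSymmetric)
    (hinj : Function.Injective S) :
    ∃ p : 𝕜[X], (aeval (S * S) p * S) * (aeval (S * S) p * S) = 1 := by
  classical
  set b := hS.eigenvectorBasis rfl with hb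
  set l := hS.eigenvalues rfl with hl
  have hSb (i) : S (b i) = (l i : 𝕜) • b i := hS.apply_eigenvectorBasis rfl i
  have hl0 (i) : l i ≠ 0 := by
    intro h
    have h1 := hSb i
    rw [h, RCLike.ofReal_zero, zero_smul, ← map_zero S] at h1
    exact b.orthonormal.ne_zero i (hinj h1)
  -- Taking the image as a finite set merges repeated squares, so the nodes are distinct.
  set s : Finset 𝕜 := Finset.univ.image fun i => (l i : 𝕜) * l i with hs
  set p := Lagrange.interpolate s id fun x => ((√(RCLike.re x))⁻¹ : ℝ) with hp
  have hpe (i) : p.eval ((l i : 𝕜) * l i) = ((|l i|⁻¹ : ℝ) : 𝕜) := by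
    have h := Lagrange.eval_interpolate_at_node (s := s) (v := id)
      (fun x : 𝕜 => (((√(RCLike.re x))⁻¹ : ℝ) : 𝕜)) Function.injective_id.injOn
      (Finset.mem_image_of_mem (fun i => (l i : 𝕜) * l i) (Finset.mem_univ i))
    rw [id] at h
    rw [hp, h, ← RCLike.ofReal_mul, RCLike.ofReal_re, Real.sqrt_mul_self_eq_abs]
  have hFb (i) : (aeval (S * S) p * S) (b i) = ((|l i|⁻¹ * l i : ℝ) : 𝕜) • b i := by
    have he : Module.End.HasEigenvector (S * S) ((l i : 𝕜) * l i) (b i) := by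
      refine ⟨Module.End.mem_eigenspace_iff.2 ?_, b.orthonormal.ne_zero i⟩
      rw [Module.End.mul_apply, hSb, map_smul, hSb, smul_smul]
    rw [Module.End.mul_apply, hSb, map_smul, Module.End.aeval_apply_of_hasEigenvector he, hpe,
      smul_smul, mul_comm, RCLike.ofReal_mul]
  refine ⟨p, b.toBasis.ext fun i => ?_⟩
  rw [b.coe_toBasis, Module.End.mul_apply, hFb, map_smul, hFb, smul_smul, ← RCLike.ofReal_mul,
    mul_mul_mul_comm, ← mul_inv, abs_mul_abs_self, inv_mul_cancel₀ (mul_ne_zero (hl0 i) (hl0 i)),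
    RCLike.ofReal_one, one_smul, Module.End.one_apply]

/-- An operator commuting or anticommuting with `S` commutes with `S²`, hence with `p (S²)`; the
remaining factor `S` decides the sign. -/
theorem exists_sign {S : Module.End 𝕜 E} (hS : S.IsSymmetric) (hinj : Function.Injective S) :
    ∃ F : Module.End 𝕜 E, F * F = 1 ∧ (∀ A, S * A = A * S → F * A = A * F) ∧
      ∀ A, S * A = -(A * S) → F * A = -(A * F) := by
  obtain ⟨p, hp⟩ := exists_polynomial_sign hS hinj
  have hcomm (A : Module.End 𝕜 E) (hA : Commute A (S * S)) :
      Commute A (Polynomial.aeval (S * S) p) := by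
    have h := Polynomial.aeval_mem_adjoin_singleton 𝕜 (p := p) (S * S)
    have h' : Algebra.adjoin 𝕜 {S * S} ≤ Subalgebra.centralizer 𝕜 {A} := by
      rw [Algebra.adjoin_le_iff, Set.singleton_subset_iff]
      exact (Subalgebra.mem_centralizer_iff 𝕜).2 fun B hB => by
        rw [Set.mem_singleton_iff.1 hB, hA.eq]
    exact (Subalgebra.mem_centralizer_iff 𝕜).1 (h' h) A rfl
  refine ⟨_, hp, fun A hA => ?_, fun A hA => ?_⟩
  · have hA' : Commute A S := hA.symm
    exact ((hcomm A (hA'.mul_right hA')).mul_right hA').eq.symm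
  · have h := hcomm A (by
      rw [Commute, SemiconjBy, mul_assoc S, hA, mul_neg, ← mul_assoc S, hA, neg_mul, neg_neg,
        mul_assoc])
    rw [mul_assoc _ S, hA, mul_neg, ← mul_assoc, ← mul_assoc, h.eq]

end Sign

/-! ### Local constancy of the indices -/

section LocallyConstant

variable {𝕜 : Type*} [RCLike 𝕜] {H : Type u} [NormedAddCommGroup H] [InnerProductSpace 𝕜 H]
  [CompleteSpace H]

namespace Reduction

variable {T : SAOp 𝕜 H} {V : Submodule 𝕜 H} [V.HasOrthogonalProjection] (r : Reduction T V)

/-- The projection onto `V` identifies the kernel of `T` with the kernel of the reduced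
operator. -/
def kerEquiv : opKer T.1 ≃ₗ[𝕜] r.kerS :=
  restrictEquiv (V.starProjection : H →ₗ[𝕜] H) (fun _ hx => r.opKer_proj_mem hx)
    (fun _ hx h => r.eq_zero_of_proj_eq_zero hx h)
    fun y hy => ⟨r.X y, r.X_mem_opKer hy.2, r.proj_X_of_mem hy.1⟩

/-- The projection onto `V` identifies the kernel of `T` with the kernel of the reduced operator
on the kernel of an operator `B` commuting with the reduction. -/
def kerInfEquiv (B : H →ₗ[𝕜] H) (hBP : ∀ x, V.starProjection (B x) = B (V.starProjection x))
    (hBX : ∀ x, r.X (B x) = B (r.X x)) :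
    (opKer T.1 ⊓ LinearMap.ker B : Submodule 𝕜 H) ≃ₗ[𝕜]
      (r.kerS ⊓ LinearMap.ker B : Submodule 𝕜 H) :=
  restrictEquiv (V.starProjection : H →ₗ[𝕜] H)
    (fun x hx => ⟨r.opKer_proj_mem hx.1, (hBP x).symm.trans (by
      rw [show B x = 0 from hx.2, map_zero])⟩)
    (fun _ hx h => r.eq_zero_of_proj_eq_zero hx.1 h)
    fun y hy => ⟨r.X y, ⟨r.X_mem_opKer hy.1.2, (hBX y).symm.trans (by
      rw [show B y = 0 from hy.2, map_zero])⟩, r.proj_X_of_mem hy.1.1⟩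

lemma S_proj (v : H) : r.S (V.starProjection v) = r.S v := by
  refine (r.unique _ _ v (r.mem_graph _) (r.S_mem _) ?_).2
  rw [r.proj_X, Submodule.starProjection_eq_self_iff.2 (V.starProjection_apply_mem v)]

lemma kerS_inv {A B : H →L[𝕜] H} (hA : ∀ x ∈ V, A x ∈ V) (h : ∀ x, r.S (A x) = B (r.S x)) :
    ∀ x ∈ r.kerS, A x ∈ r.kerS := fun x hx =>
  ⟨hA x hx.1, (h x).trans (by rw [show r.S x = 0 from hx.2, map_zero])⟩

lemma range_inv {A B : H → H} (h : ∀ x, B (r.S x) = r.S (A x)) :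
    ∀ x ∈ LinearMap.range r.S, B x ∈ LinearMap.range r.S := by
  rintro _ ⟨v, rfl⟩
  exact ⟨A v, (h v).symm⟩

/-- A symmetric operator is injective on its range; this invertibility drives the cancellation in
both indices. -/
lemma range_eq_zero {x : H} (hx : x ∈ LinearMap.range r.S) (h : r.S x = 0) : x = 0 := by
  have : x ∈ r.kerS ⊓ LinearMap.range r.S := ⟨⟨r.range_le hx, h⟩, hx⟩
  rwa [r.ker_inf_range, Submodule.mem_bot] at this

end Reduction

lemma OpCommutes.reduction {T : SAOp 𝕜 H} {T₀ : SAOp 𝕜 H} [(opKer T₀.1).HasOrthogonalProjection]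
    (r : Reduction T (opKer T₀.1)) {A : H →L[𝕜] H} (h : OpCommutes T.1 A) (h₀ : OpCommutes T₀.1 A)
    (h₀' : OpCommutes T₀.1 (star A)) :
    (∀ x, (opKer T₀.1).starProjection (A x) = A ((opKer T₀.1).starProjection x)) ∧
      (∀ x, r.X (A x) = A (r.X x)) ∧ ∀ x, r.S (A x) = A (r.S x) := by
  have hP := starProjection_comm (opKer_invariant h₀) (opKer_invariant h₀')
  have hXS := r.map_X_S (A := A) (B := A) (fun _ _ => h.graph) hP (opKer_invariant h₀)
  exact ⟨hP, fun x => (hXS x).1.symm, fun x => (hXS x).2.symm⟩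

lemma IsOdd.reduction {γ : H →L[𝕜] H} (hγ : IsGrading γ) {T : SAOp 𝕜 H} {T₀ : SAOp 𝕜 H}
    [(opKer T₀.1).HasOrthogonalProjection] (r : Reduction T (opKer T₀.1))
    (h : IsOdd γ T.1) (h₀ : IsOdd γ T₀.1) :
    (∀ x, (opKer T₀.1).starProjection (γ x) = γ ((opKer T₀.1).starProjection x)) ∧
      (∀ x, r.X (γ x) = γ (r.X x)) ∧ ∀ x, r.S (γ x) = -γ (r.S x) := by
  have hV := opKer_invariant_of_odd h₀
  have hP := starProjection_comm hV (by rwa [hγ.selfAdjoint.star_eq])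
  have hXS := r.map_X_S (A := γ) (B := -γ) (fun _ _ => h.graph) hP fun x hx => neg_mem (hV x hx)
  exact ⟨hP, fun x => (hXS x).1.symm, fun x => (hXS x).2.symm⟩

/-! ### The group case -/

section G

variable {G : Type*} [Group G] [TopologicalSpace G] {γ : H →L[𝕜] H}

lemma EvenUnitaryRep.star_toHom (ρ : EvenUnitaryRep G γ) (g : G) :
    star (ρ.toHom g : H →L[𝕜] H) = (ρ.toHom g⁻¹ : H →L[𝕜] H) := by
  rw [map_inv]; rfl

/-- In each degree `ker T₀` is `ker T` plus the corresponding part of `range S`, and `S` is an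
equivariant isomorphism between the two parts of `range S`. -/
theorem indG_eq_of_reduction (hγ : IsGrading γ) (ρ : EvenUnitaryRep G γ) (T₀ T : CFsaG ρ)
    [FiniteDimensional 𝕜 (opKer T₀.1.1)]
    (r : Reduction T.1 (opKer T₀.1.1)) : indG ρ T = indG ρ T₀ := by
  have : FiniteDimensional 𝕜 (opKer T.1.1) := T.2.1.finite_ker
  obtain ⟨hγP, hγX, hγS⟩ := IsOdd.reduction hγ r T.2.2.1 T₀.2.2.1
  have hρ (g : G) := OpCommutes.reduction r (T.2.2.2 g) (T₀.2.2.2 g)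
    (by rw [ρ.star_toHom]; exact T₀.2.2.2 g⁻¹)
  have : FiniteDimensional 𝕜 r.kerS := Submodule.finiteDimensional_of_le inf_le_left
  have : FiniteDimensional 𝕜 (LinearMap.range r.S) := Submodule.finiteDimensional_of_le r.range_le
  have hγK : ∀ x ∈ r.kerS, γ x ∈ r.kerS := fun x hx =>
    r.kerS_inv (B := -γ) (opKer_invariant_of_odd T₀.2.2.1) hγS x hx
  have hγR : ∀ x ∈ LinearMap.range r.S, γ x ∈ LinearMap.range r.S :=
    r.range_inv (A := -γ) fun x => by simp [hγS]
  have hρK (g : G) : ∀ x ∈ r.kerS, (ρ.toHom g : H →L[𝕜] H) x ∈ r.kerS := fun x hx =>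
    r.kerS_inv (opKer_invariant (T₀.2.2.2 g)) (hρ g).2.2 x hx
  have hρR (g : G) : ∀ x ∈ LinearMap.range r.S, (ρ.toHom g : H →L[𝕜] H) x ∈ LinearMap.range r.S :=
    r.range_inv fun x => ((hρ g).2.2 x).symm
  -- Stated for a general `B` so that `γ - 1` and `γ + 1` are handled at once.
  have key (B : H →L[𝕜] H) (hBP : ∀ x, (opKer T₀.1.1).starProjection (B x) =
      B ((opKer T₀.1.1).starProjection x)) (hBX : ∀ x, r.X (B x) = B (r.X x))
      (hBK : ∀ x ∈ r.kerS, B x ∈ r.kerS)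
      (hBR : ∀ x ∈ LinearMap.range r.S, B x ∈ LinearMap.range r.S)
      (hBρ : ∀ g x, B x = 0 → B ((ρ.toHom g : H →L[𝕜] H) x) = 0)
      (h1 : FiniteDimensional 𝕜 (opKer T₀.1.1 ⊓ LinearMap.ker (B : H →ₗ[𝕜] H) : Submodule 𝕜 H))
      (h2 : FiniteDimensional 𝕜 (opKer T.1.1 ⊓ LinearMap.ker (B : H →ₗ[𝕜] H) : Submodule 𝕜 H))
      (h3 : FiniteDimensional 𝕜
        (LinearMap.range r.S ⊓ LinearMap.ker (B : H →ₗ[𝕜] H) : Submodule 𝕜 H)) :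
      repClass (ρ.subrep _ fun g x (hx : x ∈ opKer T₀.1.1 ⊓ LinearMap.ker (B : H →ₗ[𝕜] H)) =>
        ⟨opKer_invariant (T₀.2.2.2 g) x hx.1, hBρ g x hx.2⟩) =
      repClass (ρ.subrep _ fun g x (hx : x ∈ opKer T.1.1 ⊓ LinearMap.ker (B : H →ₗ[𝕜] H)) =>
        ⟨opKer_invariant (T.2.2.2 g) x hx.1, hBρ g x hx.2⟩) +
      repClass (ρ.subrep _ fun g x
          (hx : x ∈ LinearMap.range r.S ⊓ LinearMap.ker (B : H →ₗ[𝕜] H)) =>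
        ⟨hρR g x hx.1, hBρ g x hx.2⟩) := by
    have : FiniteDimensional 𝕜 (r.kerS ⊓ LinearMap.ker (B : H →ₗ[𝕜] H) : Submodule 𝕜 H) :=
      Submodule.finiteDimensional_inf_left _ _
    rw [repClass_subrep_congr ρ (fun g x (hx : x ∈ opKer T.1.1 ⊓ LinearMap.ker (B : H →ₗ[𝕜] H)) =>
        ⟨opKer_invariant (T.2.2.2 g) x hx.1, hBρ g x hx.2⟩)
      (fun g x (hx : x ∈ r.kerS ⊓ LinearMap.ker (B : H →ₗ[𝕜] H)) =>
        ⟨hρK g x hx.1, hBρ g x hx.2⟩) (r.kerInfEquiv B hBP hBX) (fun g x => (hρ g).1 x)]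
    refine repClass_subrep_add ρ _ _ _ (inf_inf_eq_bot _ r.ker_inf_range) ?_
    rw [sup_inf_ker (B : H →ₗ[𝕜] H) r.ker_inf_range hBK hBR, r.ker_sup_range]
  have hsub : ∀ g x, (γ - 1) x = 0 → (γ - 1) ((ρ.toHom g : H →L[𝕜] H) x) = 0 := by
    intro g x hx
    change γ _ - (ρ.toHom g : H →L[𝕜] H) x = 0
    rw [ρ.even_apply, ← map_sub, show γ x - x = 0 from hx, map_zero]
  have hadd : ∀ g x, (γ + 1) x = 0 → (γ + 1) ((ρ.toHom g : H →L[𝕜] H) x) = 0 := by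
    intro g x hx
    change γ _ + (ρ.toHom g : H →L[𝕜] H) x = 0
    rw [ρ.even_apply, ← map_add, show γ x + x = 0 from hx, map_zero]
  have f1 := Submodule.finiteDimensional_inf_left (opKer T.1.1)
    (LinearMap.ker ((γ - 1 : H →L[𝕜] H) : H →ₗ[𝕜] H))
  have f2 := Submodule.finiteDimensional_inf_left (opKer T.1.1)
    (LinearMap.ker ((γ + 1 : H →L[𝕜] H) : H →ₗ[𝕜] H))
  have f3 := Submodule.finiteDimensional_inf_left (opKer T₀.1.1)
    (LinearMap.ker ((γ - 1 : H →L[𝕜] H) : H →ₗ[𝕜] H))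
  have f4 := Submodule.finiteDimensional_inf_left (opKer T₀.1.1)
    (LinearMap.ker ((γ + 1 : H →L[𝕜] H) : H →ₗ[𝕜] H))
  have f5 := Submodule.finiteDimensional_inf_left (LinearMap.range r.S)
    (LinearMap.ker ((γ - 1 : H →L[𝕜] H) : H →ₗ[𝕜] H))
  have f6 := Submodule.finiteDimensional_inf_left (LinearMap.range r.S)
    (LinearMap.ker ((γ + 1 : H →L[𝕜] H) : H →ₗ[𝕜] H))
  have hpos := key (γ - 1) (fun x => by simp [hγP]) (fun x => by simp [hγX])
    (fun x hx => sub_mem (hγK x hx) hx) (fun x hx => sub_mem (hγR x hx) hx) hsub f3 f1 f5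
  have hneg := key (γ + 1) (fun x => by simp [hγP]) (fun x => by simp [hγX])
    (fun x hx => add_mem (hγK x hx) hx) (fun x hx => add_mem (hγR x hx) hx) hadd f4 f2 f6
  have hS := repClass_subrep_congr ρ (fun g x
      (hx : x ∈ LinearMap.range r.S ⊓ LinearMap.ker ((γ - 1 : H →L[𝕜] H) : H →ₗ[𝕜] H)) =>
        ⟨hρR g x hx.1, hsub g x hx.2⟩)
    (fun g x (hx : x ∈ LinearMap.range r.S ⊓ LinearMap.ker ((γ + 1 : H →L[𝕜] H) : H →ₗ[𝕜] H)) =>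
        ⟨hρR g x hx.1, hadd g x hx.2⟩)
    (restrictEquiv r.S
      (fun x hx => ⟨⟨x, rfl⟩, by
        have h : γ x = x := sub_eq_zero.1 hx.2
        change γ (r.S x) + r.S x = 0
        have h' := hγS x
        rw [h] at h'
        nth_rw 2 [h']
        exact add_neg_cancel _⟩)
      (fun x hx h => r.range_eq_zero hx.1 h) (by
        rintro y ⟨hy, hyγ⟩
        -- `S` maps its range onto itself: `S v = S (P v)`, and the kernel component of `P v` may be
        -- dropped.
        have hy' : y ∈ (LinearMap.range r.S).map r.S := by
          obtain ⟨v, rfl⟩ := hy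
          have hv : (opKer T₀.1.1).starProjection v ∈ r.kerS ⊔ LinearMap.range r.S := by
            rw [r.ker_sup_range]
            exact Submodule.starProjection_apply_mem _ v
          obtain ⟨k, hk, l, hl, hkl⟩ := Submodule.mem_sup.1 hv
          refine ⟨l, hl, ?_⟩
          rw [← r.S_proj v, ← hkl, map_add, show r.S k = 0 from hk.2, zero_add]
        obtain ⟨x, hx, rfl⟩ := hy'
        refine ⟨x, ⟨hx, ?_⟩, rfl⟩
        -- The preimage is even because `S (γ x - x) = -(γ + 1) (S x) = 0` and `S` is injective on
        -- its range.
        refine r.range_eq_zero (sub_mem (hγR x hx) hx) ?_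
        change r.S (γ x - x) = 0
        rw [map_sub, hγS, sub_eq_add_neg, ← neg_add]
        exact neg_eq_zero.2 hyγ))
    (fun g x => (hρ g).2.2 x)
  refine Eq.trans ?_ (congrArg₂ (· - ·) hpos hneg).symm
  rw [hS]
  exact (add_sub_add_right_eq_sub _ _ _).symm

theorem isLocallyConstant_indG (hγ : IsGrading γ) (ρ : EvenUnitaryRep G γ) :
    IsLocallyConstant (indG ρ) := by
  rw [IsLocallyConstant.iff_eventually_eq]
  intro T₀
  have : FiniteDimensional 𝕜 (opKer T₀.1.1) := T₀.2.1.finite_ker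
  filter_upwards [continuous_subtype_val.continuousAt.eventually
    (eventually_nonempty_reduction T₀.2.1)] with T ⟨r⟩
  exact indG_eq_of_reduction hγ ρ T₀ T r

end G

/-! ### The Clifford case -/

section Clifford

variable {n : ℕ} {γ : H →L[𝕜] H}

/-- The sign of the invertible restriction of `S` to its range is the odd Clifford linear involution
required by `clClass_submodule_eq_zero`. -/
lemma Reduction.clClass_range (hγ : IsGrading γ) (ρ : GradedClRep n γ) {T : SAOp 𝕜 H}
    {V : Submodule 𝕜 H} [V.HasOrthogonalProjection] [FiniteDimensional 𝕜 V] (r : Reduction T V)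
    [FiniteDimensional 𝕜 (LinearMap.range r.S)]
    (hγS : ∀ x, r.S (γ x) = -γ (r.S x)) (hρS : ∀ a x, r.S (ρ.toHom a x) = ρ.toHom a (r.S x))
    (hR : ∀ a, ∀ x ∈ LinearMap.range r.S, ρ.toHom a x ∈ LinearMap.range r.S)
    (hR' : ∀ x ∈ LinearMap.range r.S, γ x ∈ LinearMap.range r.S) :
    clClass (ρ.submodule hγ _ hR hR') = 0 := by
  set S : Module.End 𝕜 (LinearMap.range r.S) := r.S.restrict fun x _ => ⟨x, rfl⟩ with hS
  have hsymm : S.IsSymmetric := r.isSymmetric.restrict_invariant _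
  have hinj : Function.Injective S := by
    rw [injective_iff_map_eq_zero]
    exact fun x h => Subtype.ext (r.range_eq_zero x.2 (congrArg Subtype.val h))
  obtain ⟨F, hF, hcomm, hanti⟩ := exists_sign hsymm hinj
  refine clClass_submodule_eq_zero hγ ρ hR hR' F (fun x => LinearMap.congr_fun hF x)
    (fun x => ?_) fun a x => ?_
  · have h := hanti ((γ : H →ₗ[𝕜] H).restrict hR')
      (LinearMap.ext fun x => Subtype.ext (hγS x))
    exact eq_neg_iff_add_eq_zero.2 (neg_eq_iff_add_eq_zero.1
      (congrArg Subtype.val (LinearMap.congr_fun h x)).symm)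
  · have h := hcomm ((ρ.toHom a : H →ₗ[𝕜] H).restrict (hR a))
      (LinearMap.ext fun x => Subtype.ext (hρS a x))
    exact congrArg Subtype.val (LinearMap.congr_fun h x)

theorem indCl_eq_of_reduction (hγ : IsGrading γ) (ρ : GradedClRep n γ) (T₀ T : CFsaCl ρ)
    [FiniteDimensional 𝕜 (opKer T₀.1.1)]
    (r : Reduction T.1 (opKer T₀.1.1)) : indCl hγ ρ T = indCl hγ ρ T₀ := by
  have : FiniteDimensional 𝕜 (opKer T.1.1) := T.2.1.finite_ker
  obtain ⟨hγP, hγX, hγS⟩ := IsOdd.reduction hγ r T.2.2.1 T₀.2.2.1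
  have hρ (a : Cl n) := OpCommutes.reduction r (T.2.2.2 a) (T₀.2.2.2 a)
    (by rw [← ρ.map_star]; exact T₀.2.2.2 (star a))
  have : FiniteDimensional 𝕜 r.kerS := Submodule.finiteDimensional_of_le inf_le_left
  have : FiniteDimensional 𝕜 (LinearMap.range r.S) := Submodule.finiteDimensional_of_le r.range_le
  have hγK : ∀ x ∈ r.kerS, γ x ∈ r.kerS := fun x hx =>
    r.kerS_inv (B := -γ) (opKer_invariant_of_odd T₀.2.2.1) hγS x hx
  have hγR : ∀ x ∈ LinearMap.range r.S, γ x ∈ LinearMap.range r.S :=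
    r.range_inv (A := -γ) fun x => by simp [hγS]
  have hρK (a : Cl n) : ∀ x ∈ r.kerS, ρ.toHom a x ∈ r.kerS := fun x hx =>
    r.kerS_inv (opKer_invariant (T₀.2.2.2 a)) (hρ a).2.2 x hx
  have hρR (a : Cl n) : ∀ x ∈ LinearMap.range r.S, ρ.toHom a x ∈ LinearMap.range r.S :=
    r.range_inv fun x => ((hρ a).2.2 x).symm
  have h1 : indCl hγ ρ T = clClass (ρ.submodule hγ r.kerS hρK hγK) :=
    clClass_submodule_congr hγ ρ _ _ _ _ r.kerEquiv (fun a x => (hρ a).1 x) fun x => hγP x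
  have h2 : indCl hγ ρ T₀ = clClass (ρ.submodule hγ r.kerS hρK hγK) +
      clClass (ρ.submodule hγ _ hρR hγR) :=
    clClass_submodule_add hγ ρ _ _ _ _ _ _ r.ker_inf_range r.ker_sup_range
  rw [h1, h2, r.clClass_range hγ ρ hγS (fun a => (hρ a).2.2), add_zero]

theorem isLocallyConstant_indCl (hγ : IsGrading γ) (ρ : GradedClRep n γ) :
    IsLocallyConstant (indCl hγ ρ) := by
  rw [IsLocallyConstant.iff_eventually_eq]
  intro T₀
  have : FiniteDimensional 𝕜 (opKer T₀.1.1) := T₀.2.1.finite_ker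
  filter_upwards [continuous_subtype_val.continuousAt.eventually
    (eventually_nonempty_reduction T₀.2.1)] with T ⟨r⟩
  exact indCl_eq_of_reduction hγ ρ T₀ T r

end Clifford

end LocallyConstant

end EquivariantIndex

end

open EquivariantIndex
theorem mainTheorem3 {𝕜 : Type*} [RCLike 𝕜] {H : Type*} [NormedAddCommGroup H]
    [InnerProductSpace 𝕜 H] [CompleteSpace H] {γ : H →L[𝕜] H} (hγ : IsGrading γ) :
    (∀ (G : Type*) [Group G] [TopologicalSpace G] [CompactSpace G] [T2Space G] (d : ℕ)
        [ChartedSpace (EuclideanSpace ℝ (Fin d)) G] [LieGroup (𝓡 d) ∞ G]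
        (ρ : EvenUnitaryRep G γ), IsLocallyConstant (indG ρ)) ∧
    (∀ (n : ℕ) (ρ : GradedClRep n γ), IsLocallyConstant (indCl hγ ρ)) :=
  ⟨fun _ _ _ _ _ _ _ _ ρ => isLocallyConstant_indG hγ ρ,
    fun _ ρ => isLocallyConstant_indCl hγ ρ⟩
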